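/- Let $k\ge 2$ be an integer and let $\alpha\in\mathbb C$ with $0<|\alpha|<2$. Write $\Omega(n)$ for the number of prime factors of $n$ counted with multiplicity, and for $f:\mathbb R\to\mathbb C$ and real $N\ge 2$ put $$S_{f}(k,\alpha;N)=\sum_{\substack{n\ \ k\text{-free}\\ p\mid n\Rightarrow p\le N}} f\!\left(\frac{\log n}{\log N}\right)\frac{\alpha^{\Omega(n)}}{n},\qquad \varphi^{(\alpha)}(\lambda)=\exp\left\{\alpha\int_0^1\frac{e^{i\lambda v}-1}{v}\,dv\right\}.$$ Then there is a constant $C=C(k,\alpha)\neq 0$ with the following property. Let $\eta>|\alpha|-\Re\alpha+1$ and let $f:\mathbb R\to\mathbb C$ be a bounded continuous function whose Fourier transform $\hat f$ (normalized as $\hat f(\lambda)=\frac1{2\pi}\int_{\mathbb R} f(x)e^{-i\lambda x}\,dx$, and understood in the sense of tempered distributions if $f$ is not integrable) is a function satisfying $|\hat f(\lambda)|\le A/(1+|\lambda|^\eta)$ for all $\lambda\in\mathbb R$ and some $A>0$. For $\tau\in\mathbb R$ put $R(N)=(\log N)^{1-\tau}$ and define $\varepsilon_N$ by $$S_{f}(k,\alpha;N)=C\,(\log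 N)^{\alpha}\left(\int_{|\lambda|\le R(N)}\varphi^{(\alpha)}(\lambda)\hat f(\lambda)\,d\lambda+\varepsilon_N\right)\qquad(N\ge2).$$ Then, as $N\to\infty$, (a) if $0<\tau\le\frac{\eta-(|\alpha|-\Re\alpha+2)}{\eta-1}$, then $\varepsilon_N=O\!\left(\frac{\log\log N}{\log N}\right)$; (b) if $\max\left(0,\frac{\eta-(|\alpha|-\Re\alpha+2)}{\eta-1}\right)<\tau<\frac{\eta-(|\alpha|-\Re\alpha+1)}{\eta-1}$, then $\varepsilon_N=O\!\left((\log N)^{-\eta(1-\tau)-\tau+|\alpha|-\Re\alpha+1}\right)$. The implied constants may depend on $k,\alpha,\eta,f,\tau$. -/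

import Mathlib

namespace SmoothSums

/-- The `k`-free positive integers all of whose prime factors are at most `N`
(`0` is excluded, as it is divisible by every prime power). -/
def smoothKFree (k : ℕ) (N : ℝ) : Set ℕ :=
  {n : ℕ | (∀ p : ℕ, p.Prime → ¬ p ^ k ∣ n) ∧ ∀ p : ℕ, p.Prime → p ∣ n → (p : ℝ) ≤ N}

theorem smoothKFree_finite (k : ℕ) (N : ℝ) : (smoothKFree k N).Finite := by
  have hQ : (∏ p ∈ (Finset.range (⌊N⌋₊ + 1)).filter Nat.Prime, p ^ k) ≠ 0 :=
    Finset.prod_ne_zero_iff.mpr fun p hp =>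
      pow_ne_zero _ (Finset.mem_filter.mp hp).2.ne_zero
  refine (Nat.divisors
    (∏ p ∈ (Finset.range (⌊N⌋₊ + 1)).filter Nat.Prime, p ^ k)).finite_toSet.subset ?_
  rintro n ⟨hn, hN⟩
  simp only [Finset.mem_coe, Nat.mem_divisors]
  refine ⟨(Nat.dvd_iff_prime_pow_dvd_dvd _ _).mpr fun p j hp hj => ?_, hQ⟩
  rcases Nat.eq_zero_or_pos j with rfl | hj0
  · simp
  have hpn : p ∣ n := (dvd_pow_self p hj0.ne').trans hj
  have hjk : j ≤ k := by
    by_contra! h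
    exact hn p hp ((pow_dvd_pow p h.le).trans hj)
  refine (pow_dvd_pow p hjk).trans (Finset.dvd_prod_of_mem (fun p => p ^ k) ?_)
  simp only [Finset.mem_filter, Finset.mem_range]
  exact ⟨Nat.lt_succ_of_le (Nat.le_floor (hN p hp hpn)), hp⟩

/-- The sum of `f (log n / log N) * α ^ Ω(n) / n` over the `k`-free `N`-smooth integers `n`,
where `Ω(n)` counts the prime divisors of `n` with multiplicity. -/
noncomputable def smoothSum (f : ℝ → ℂ) (k : ℕ) (α : ℂ) (N : ℝ) : ℂ :=
  ∑ n ∈ (smoothKFree_finite k N).toFinset,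
    f (Real.log n / Real.log N) * (α ^ ArithmeticFunction.cardFactors n / (n : ℂ))

/-- The Fourier transform in the normalization
`(1 / 2π) ∫ f(x) exp(-iλx) dx`, inverse to `g ↦ ∫ g(λ) exp(iλx) dλ`. -/
noncomputable def fourierTransform (f : ℝ → ℂ) (lam : ℝ) : ℂ :=
  (1 / (2 * (Real.pi : ℂ))) * ∫ x : ℝ, Complex.exp (-(Complex.I * lam * x)) * f x

/-- `g` is the Fourier transform of `f` in the sense of tempered distributions (for integrable
`f` this holds with `g = fourierTransform f`). -/
def IsFourierTransform (f g : ℝ → ℂ) : Prop :=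
  ∀ ψ : SchwartzMap ℝ ℂ,
    MeasureTheory.Integrable (fun lam : ℝ => g lam * ψ lam) ∧
      ∫ lam : ℝ, g lam * ψ lam = ∫ x : ℝ, f x * fourierTransform ψ x

/-- `f` belongs to the space `S_η`, with Fourier transform `fhat`. -/
def MemS (η : ℝ) (f fhat : ℝ → ℂ) : Prop :=
  IsFourierTransform f fhat ∧ ∃ A : ℝ, 0 < A ∧ ∀ lam : ℝ, ‖fhat lam‖ ≤ A / (1 + |lam| ^ η)

/-- The characteristic function of the `α`-convolution of the Dickman-de Bruijn distribution. -/
noncomputable def dickmanChar (α : ℂ) (lam : ℝ) : ℂ :=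
  Complex.exp (α * ∫ v in (0 : ℝ)..1, (Complex.exp (Complex.I * lam * v) - 1) / (v : ℂ))

/-- The integral over `|λ| ≤ R` of `dickmanChar α λ * fhat λ`. -/
noncomputable def mainIntegral (α : ℂ) (fhat : ℝ → ℂ) (R : ℝ) : ℂ :=
  ∫ lam in {lam : ℝ | |lam| ≤ R}, dickmanChar α lam * fhat lam

end SmoothSums

/-!
By Fourier inversion `f (log n / log N)` is a superposition of the twists `n ^ (iλ / log N)`, so
`smoothSum` is the integral of `fhat λ` against the Euler product over the primes `p ≤ N` of the
local factors `1 + w + ⋯ + w ^ (k - 1)`, where `w = α p ^ (iλ / log N) / p`. As `‖α‖ < 2`, each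
local factor is `exp (w + O(w ^ 2))`; the second-order terms converge to a constant, and by Mertens'
theorem and partial summation the sum of the `w` is `α log log N + α ∫₀¹ (exp (iλv) - 1) / v dv`
plus a constant, with an error `O((1 + |λ|) log log N / log N)`. Hence the Euler product is
`C (log N) ^ α * dickmanChar α λ` up to a relative error that is small for
`|λ| ≤ (log N) ^ (1 - τ)`. For the larger `|λ|` its size is at most a constant times
`(log N) ^ ‖α‖`, and the decay of `fhat` gives the second error term.
-/

namespace SmoothSums

open Finset Filter Real MeasureTheory Asymptotics
open scoped FourierTransform

/-! ### Mertens' theorems -/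

theorem summable_log_div_rpow {s : ℝ} (hs : 1 < s) :
    Summable fun n : ℕ => log n / (n : ℝ) ^ s := by
  have hlog : log =O[atTop] fun x : ℝ => x ^ ((s - 1) / 2) :=
    (isLittleO_log_rpow_atTop (by linarith)).isBigO
  have hterm : (fun x => log x / x ^ s) =O[atTop] fun x : ℝ => x ^ (-((s + 1) / 2)) := by
    refine (hlog.mul (isBigO_refl (fun x : ℝ => (x ^ s)⁻¹) _)).congr'
      (.of_forall fun x => (div_eq_mul_inv _ _).symm) ?_
    filter_upwards [eventually_gt_atTop 0] with x hx
    rw [← rpow_neg hx.le, ← rpow_add hx]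
    ring_nf
  exact summable_of_isBigO_nat (Real.summable_nat_rpow.mpr (by linarith))
    (hterm.comp_tendsto tendsto_natCast_atTop_atTop)

/-- The sum of `log p / p` over the primes `p ≤ x`, the subject of Mertens' first theorem. -/
noncomputable def primeLogSum (x : ℝ) : ℝ := ∑ p ∈ Nat.primesLE ⌊x⌋₊, log p / p

theorem primeLogSum_mono : Monotone primeLogSum := fun _ _ hxy =>
  sum_le_sum_of_subset_of_nonneg (Nat.primesLE_mono (Nat.floor_mono hxy))
    fun _ _ _ => by positivity

theorem log_factorial_eq_sum_primesLE (n : ℕ) :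
    log n.factorial = ∑ p ∈ Nat.primesLE n, n.factorial.factorization p * log p := by
  conv_lhs => rw [← Nat.prod_factorization_pow_eq_self n.factorial_ne_zero]
  rw [Nat.prod_factorization_eq_prod_primeFactors, Nat.cast_prod, log_prod fun p hp => by
    exact_mod_cast pow_ne_zero _ (Nat.prime_of_mem_primeFactors hp).ne_zero]
  simp only [Nat.cast_pow, log_pow]
  refine sum_subset (fun p hp => ?_) fun p _ hp => ?_
  · have hpp := Nat.prime_of_mem_primeFactors hp
    exact Nat.mem_primesLE.mpr ⟨hpp.dvd_factorial.mp (Nat.dvd_of_mem_primeFactors hp), hpp⟩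
  · rw [← Nat.support_factorization] at hp
    simp [Finsupp.notMem_support_iff.mp hp]

theorem div_le_factorization_factorial {p n : ℕ} (hp : p.Prime) (hpn : p ≤ n) :
    n / p ≤ n.factorial.factorization p := by
  rw [Nat.factorization_factorial hp (b := Nat.log p n + 1) (Nat.lt_succ_self _)]
  have hmem : 1 ∈ Ico 1 (Nat.log p n + 1) := by
    have := Nat.log_pos hp.one_lt hpn
    simp only [mem_Ico]
    omega
  simpa using single_le_sum (f := fun i => n / p ^ i) (fun _ _ => Nat.zero_le _) hmem

theorem mul_primeLogSum_sub_theta_le_log_factorial (n : ℕ) :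
    n * primeLogSum n - Chebyshev.theta n ≤ log n.factorial := by
  rw [log_factorial_eq_sum_primesLE, Chebyshev.theta_eq_sum_primesLE_log, primeLogSum,
    Nat.floor_natCast, mul_sum, ← sum_sub_distrib]
  refine sum_le_sum fun p hp => ?_
  have hle : (n : ℝ) / p - 1 ≤ n.factorial.factorization p := calc
    (n : ℝ) / p - 1 ≤ (n / p : ℕ) := by
      rw [← Nat.floor_div_eq_div (K := ℝ)]
      exact (Nat.sub_one_lt_floor _).le
    _ ≤ _ := by
      exact_mod_cast div_le_factorization_factorial (Nat.prime_of_mem_primesLE hp)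
        (Nat.le_of_mem_primesLE hp)
  calc (n : ℝ) * (log p / p) - log p = (n / p - 1) * log p := by ring
    _ ≤ _ := mul_le_mul_of_nonneg_right hle (log_natCast_nonneg p)

theorem log_factorial_le_mul_sum_primesLE (n : ℕ) :
    log n.factorial ≤ n * ∑ p ∈ Nat.primesLE n, log p / (p - 1) := by
  rw [log_factorial_eq_sum_primesLE, mul_sum]
  refine sum_le_sum fun p hp => ?_
  have hp := Nat.prime_of_mem_primesLE hp
  have hle : (n.factorial.factorization p : ℝ) ≤ n / (p - 1) := calc
    (n.factorial.factorization p : ℝ) ≤ (n / (p - 1) : ℕ) := by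
      exact_mod_cast Nat.factorization_factorial_le_div_pred hp n
    _ ≤ n / ((p - 1 : ℕ) : ℝ) := Nat.cast_div_le
    _ = n / (p - 1) := by rw [Nat.cast_sub hp.one_le, Nat.cast_one]
  calc _ ≤ n / (p - 1) * log p := mul_le_mul_of_nonneg_right hle (log_natCast_nonneg p)
    _ = _ := by ring

theorem sum_primesLE_log_div_sub_one_le (n : ℕ) :
    ∑ p ∈ Nat.primesLE n, log p / ((p : ℝ) - 1) ≤
      primeLogSum n + 2 * ∑' m : ℕ, log m / (m : ℝ) ^ (2 : ℝ) := by
  have hterm : ∀ p ∈ Nat.primesLE n,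
      log p / ((p : ℝ) - 1) ≤ log p / p + 2 * (log p / (p : ℝ) ^ (2 : ℝ)) := fun p hp => by
    have hp2 : (2 : ℝ) ≤ p := by exact_mod_cast (Nat.prime_of_mem_primesLE hp).two_le
    have hlog := log_natCast_nonneg p
    have hdiff : log p / p + 2 * (log p / (p : ℝ) ^ 2) - log p / ((p : ℝ) - 1) =
        log p * (p - 2) / (p ^ 2 * (p - 1)) := by
      have : (p : ℝ) - 1 ≠ 0 := by linarith
      field_simp
      ring
    have : 0 ≤ log p * (p - 2) / (p ^ 2 * ((p : ℝ) - 1)) :=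
      div_nonneg (mul_nonneg hlog (by linarith)) (mul_nonneg (by positivity) (by linarith))
    rw [rpow_two]
    linarith
  refine (sum_le_sum hterm).trans ?_
  rw [sum_add_distrib, ← mul_sum, primeLogSum, Nat.floor_natCast]
  gcongr
  exact (summable_log_div_rpow one_lt_two).sum_le_tsum _ fun _ _ => by positivity

theorem primeLogSum_natCast_le {n : ℕ} (hn : n ≠ 0) : primeLogSum n ≤ log n + log 4 := by
  have hn' : (0 : ℝ) < n := by positivity
  have hfact : log n.factorial ≤ n * log n := by
    rw [← log_pow]
    exact log_le_log (by positivity) (by exact_mod_cast n.factorial_le_pow)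
  have := mul_primeLogSum_sub_theta_le_log_factorial n
  have := Chebyshev.theta_le_log4_mul_x hn'.le
  exact le_of_mul_le_mul_left (by linarith : n * primeLogSum n ≤ n * (log n + log 4)) hn'

theorem log_sub_le_primeLogSum_natCast {n : ℕ} (hn : n ≠ 0) :
    log n - (1 + 2 * ∑' m : ℕ, log m / (m : ℝ) ^ (2 : ℝ)) ≤ primeLogSum n := by
  set T := ∑' m : ℕ, log m / (m : ℝ) ^ (2 : ℝ)
  have hn' : (0 : ℝ) < n := by positivity
  have hstirling : n * log n - n ≤ log n.factorial := by
    have := Stirling.le_log_factorial_stirling hn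
    have : 0 ≤ log (2 * π) := log_nonneg (by linarith [pi_gt_three])
    linarith [log_natCast_nonneg n]
  have hupper : log n.factorial ≤ n * (primeLogSum n + 2 * T) :=
    (log_factorial_le_mul_sum_primesLE n).trans
      (mul_le_mul_of_nonneg_left (sum_primesLE_log_div_sub_one_le n) hn'.le)
  have := le_of_mul_le_mul_left
    (by linarith : n * (log n - 1) ≤ n * (primeLogSum n + 2 * T)) hn'
  linarith

/-- The error term in Mertens' first theorem. -/
noncomputable def primeLogError (x : ℝ) : ℝ := primeLogSum x - log x

theorem measurable_primeLogError : Measurable primeLogError :=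
  primeLogSum_mono.measurable.sub measurable_log

theorem exists_abs_primeLogError_le : ∃ K, 0 < K ∧ ∀ x, 1 ≤ x → |primeLogError x| ≤ K := by
  set T := ∑' m : ℕ, log m / (m : ℝ) ^ (2 : ℝ)
  have hT : 0 ≤ T := tsum_nonneg fun m => by positivity
  have hlog4 : 0 ≤ log 4 := log_nonneg (by norm_num)
  refine ⟨2 + log 4 + 2 * T, by positivity, fun x hx => ?_⟩
  have hn : ⌊x⌋₊ ≠ 0 := (Nat.floor_pos.mpr hx).ne'
  have hn1 : (1 : ℝ) ≤ ⌊x⌋₊ := by exact_mod_cast Nat.one_le_iff_ne_zero.mpr hn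
  have hfloor : log ⌊x⌋₊ ≤ log x := log_le_log (by linarith) (Nat.floor_le (by linarith))
  have hceil : log x ≤ log ⌊x⌋₊ + log 2 := by
    rw [← log_mul (by positivity) two_ne_zero]
    exact log_le_log (by linarith) (by linarith [Nat.lt_floor_add_one x])
  have hupper := primeLogSum_natCast_le hn
  have hlower := log_sub_le_primeLogSum_natCast hn
  have hx' : primeLogSum x = primeLogSum ⌊x⌋₊ := by simp [primeLogSum]
  rw [primeLogError, hx', abs_le]
  constructor <;> linarith [log_two_lt_d9]

section AbelSummation

variable {𝕜 : Type*} [RCLike 𝕜]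

theorem intervalIntegrable_primeLogError (a b : ℝ) :
    IntervalIntegrable primeLogError volume a b :=
  primeLogSum_mono.intervalIntegrable.sub intervalIntegral.intervalIntegrable_log'

theorem intervalIntegrable_ofReal {f : ℝ → ℝ} {a b : ℝ} (hf : IntervalIntegrable f volume a b) :
    IntervalIntegrable (fun x => (f x : 𝕜)) volume a b :=
  ⟨hf.1.ofReal, hf.2.ofReal⟩

theorem sum_primesLE_mul_log_div_eq_sub_integral {f f' : ℝ → 𝕜} {b : ℝ} (hb : 2 ≤ b)
    (hf : ∀ x ∈ Set.Icc 2 b, HasDerivAt f (f' x) x) (hf' : ContinuousOn f' (Set.Icc 2 b)) :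
    ∑ p ∈ Nat.primesLE ⌊b⌋₊, f p * (log p / p : ℝ) =
      f b * primeLogSum b - ∫ x in 2..b, f' x * primeLogSum x := by
  set c : ℕ → 𝕜 := fun n => if n.Prime then ((log n / n : ℝ) : 𝕜) else 0 with hc
  have hsum : ∀ x : ℝ, ∑ n ∈ Icc 0 ⌊x⌋₊, c n = primeLogSum x := fun x => by
    simp only [hc, primeLogSum, Nat.primesLE_eq_filter_Icc_zero, ← sum_filter, map_sum]
  have hderiv : Set.EqOn f' (deriv f) (Set.Icc 2 b) := fun x hx => (hf x hx).deriv.symm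
  have habel := sum_mul_eq_sub_integral_mul₁ c (f := f) (by simp [hc])
    (by simp [hc, Nat.not_prime_one]) b (fun t ht => (hf t ht).differentiableAt)
    (hf'.integrableOn_Icc.congr_fun hderiv measurableSet_Icc)
  simp only [hsum] at habel
  have hlhs : ∑ p ∈ Nat.primesLE ⌊b⌋₊, f p * (log p / p : ℝ) = ∑ n ∈ Icc 0 ⌊b⌋₊, f n * c n := by
    simp only [hc, mul_ite, mul_zero, Nat.primesLE_eq_filter_Icc_zero, sum_filter]
  rw [hlhs, habel, intervalIntegral.integral_of_le hb]
  congr 1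
  exact setIntegral_congr_fun measurableSet_Ioc fun x hx => by
    simp only [hderiv (Set.Ioc_subset_Icc_self hx)]

theorem integral_deriv_mul_log {f f' : ℝ → 𝕜} {a b : ℝ} (ha : 0 < a) (hab : a ≤ b)
    (hf : ∀ x ∈ Set.Icc a b, HasDerivAt f (f' x) x) (hf' : ContinuousOn f' (Set.Icc a b)) :
    ∫ x in a..b, f' x * log x = f b * log b - f a * log a - ∫ x in a..b, f x / x := by
  rw [← Set.uIcc_of_le hab] at hf hf'
  have hne : ∀ x ∈ Set.uIcc a b, x ≠ 0 := fun x hx =>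
    (ha.trans_le ((Set.uIcc_of_le hab) ▸ hx).1).ne'
  have hinv : ContinuousOn (fun x : ℝ => ((x⁻¹ : ℝ) : 𝕜)) (Set.uIcc a b) :=
    RCLike.continuous_ofReal.comp_continuousOn (continuousOn_inv₀.mono hne)
  have hparts := intervalIntegral.integral_mul_deriv_eq_deriv_mul hf
    (v := fun x => ((log x : ℝ) : 𝕜))
    (fun x hx => RCLike.ofRealCLM.hasFDerivAt.comp_hasDerivAt x (hasDerivAt_log (hne x hx)))
    hf'.intervalIntegrable hinv.intervalIntegrable
  simp only [RCLike.ofRealCLM_apply, RCLike.ofReal_inv, ← div_eq_mul_inv] at hparts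
  rw [hparts, sub_sub_cancel]

theorem sum_primesLE_mul_log_div_eq_integral_add {f f' : ℝ → 𝕜} {b : ℝ} (hb : 2 ≤ b)
    (hf : ∀ x ∈ Set.Icc 2 b, HasDerivAt f (f' x) x) (hf' : ContinuousOn f' (Set.Icc 2 b)) :
    ∑ p ∈ Nat.primesLE ⌊b⌋₊, f p * (log p / p : ℝ) =
      (∫ x in 2..b, f x / x) + f 2 * log 2 + f b * primeLogError b -
        ∫ x in 2..b, f' x * primeLogError x := by
  have hcont : ContinuousOn f' (Set.uIcc 2 b) := by rwa [Set.uIcc_of_le hb]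
  have hsplit : ∫ x in 2..b, f' x * primeLogSum x =
      (∫ x in 2..b, f' x * log x) + ∫ x in 2..b, f' x * primeLogError x := by
    rw [← intervalIntegral.integral_add
      ((intervalIntegrable_ofReal intervalIntegral.intervalIntegrable_log').continuousOn_mul hcont)
      ((intervalIntegrable_ofReal (intervalIntegrable_primeLogError 2 b)).continuousOn_mul hcont)]
    simp only [← mul_add, ← RCLike.ofReal_add, primeLogError, add_sub_cancel]
  have herr : (primeLogSum b : 𝕜) = log b + primeLogError b := by
    rw [← RCLike.ofReal_add, primeLogError, add_sub_cancel]
  rw [sum_primesLE_mul_log_div_eq_sub_integral hb hf hf', hsplit,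
    integral_deriv_mul_log two_pos hb hf hf', herr]
  ring

end AbelSummation

theorem hasDerivAt_neg_inv_log {x : ℝ} (hx : 1 < x) :
    HasDerivAt (fun y => -(log y)⁻¹) (1 / (x * log x ^ 2)) x := by
  have h := ((hasDerivAt_log (by linarith : x ≠ 0)).fun_inv (log_pos hx).ne').fun_neg
  rwa [neg_div, neg_neg, inv_eq_one_div, div_div] at h

theorem hasDerivAt_log_log {x : ℝ} (hx : 1 < x) :
    HasDerivAt (fun y => log (log y)) (1 / (x * log x)) x := by
  have h := (hasDerivAt_log (by linarith : x ≠ 0)).log (log_pos hx).ne'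
  rwa [inv_eq_one_div, div_div] at h

theorem continuousOn_one_div_mul_log_pow (n : ℕ) :
    ContinuousOn (fun x => 1 / (x * log x ^ n)) (Set.Ioi 1) := fun x hx => by
  have hx0 : x ≠ 0 := by linarith [Set.mem_Ioi.mp hx]
  have hlog : log x ≠ 0 := (log_pos hx).ne'
  refine ContinuousAt.continuousWithinAt ?_
  fun_prop (disch := positivity)

theorem tendsto_neg_inv_log : Tendsto (fun y => -(log y)⁻¹) atTop (nhds 0) := by
  simpa using (tendsto_inv_atTop_zero.comp tendsto_log_atTop).neg

theorem integrableOn_one_div_mul_log_sq {a : ℝ} (ha : 1 < a) :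
    IntegrableOn (fun x => 1 / (x * log x ^ 2)) (Set.Ioi a) :=
  integrableOn_Ioi_deriv_of_nonneg' (fun _ hx => hasDerivAt_neg_inv_log (ha.trans_le hx))
    (fun x hx => by have := (one_pos.trans ha).trans hx; positivity) tendsto_neg_inv_log

theorem integral_Ioi_one_div_mul_log_sq {a : ℝ} (ha : 1 < a) :
    ∫ x in Set.Ioi a, 1 / (x * log x ^ 2) = 1 / log a := by
  rw [integral_Ioi_of_hasDerivAt_of_tendsto'
    (fun _ hx => hasDerivAt_neg_inv_log (ha.trans_le hx))
    (integrableOn_one_div_mul_log_sq ha) tendsto_neg_inv_log]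
  simp

theorem intervalIntegrable_one_div_mul_log {a b : ℝ} (ha : 1 < a) (hab : a ≤ b) :
    IntervalIntegrable (fun x => 1 / (x * log x)) volume a b := by
  refine ContinuousOn.intervalIntegrable ?_
  rw [Set.uIcc_of_le hab]
  simpa only [pow_one] using
    (continuousOn_one_div_mul_log_pow 1).mono fun x hx => ha.trans_le hx.1

theorem integral_one_div_mul_log {a b : ℝ} (ha : 1 < a) (hab : a ≤ b) :
    ∫ x in a..b, 1 / (x * log x) = log (log b) - log (log a) :=
  intervalIntegral.integral_eq_sub_of_hasDerivAt
    (fun _ hx => hasDerivAt_log_log (ha.trans_le (Set.uIcc_of_le hab ▸ hx).1))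
    (intervalIntegrable_one_div_mul_log ha hab)

theorem exists_norm_one_div_mul_log_sq_mul_primeLogError_le :
    ∃ K, 0 < K ∧ ∀ x, 1 ≤ x →
      ‖1 / (x * log x ^ 2) * primeLogError x‖ ≤ K * (1 / (x * log x ^ 2)) := by
  obtain ⟨K, hK, herr⟩ := exists_abs_primeLogError_le
  refine ⟨K, hK, fun x hx => ?_⟩
  have hnonneg : 0 ≤ 1 / (x * log x ^ 2) := by positivity
  rw [norm_mul, Real.norm_of_nonneg hnonneg, mul_comm]
  exact mul_le_mul_of_nonneg_right (herr x hx) hnonneg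

theorem integrableOn_one_div_mul_log_sq_mul_primeLogError {a : ℝ} (ha : 1 < a) :
    IntegrableOn (fun x => 1 / (x * log x ^ 2) * primeLogError x) (Set.Ioi a) := by
  obtain ⟨K, -, hbound⟩ := exists_norm_one_div_mul_log_sq_mul_primeLogError_le
  refine Integrable.mono' ((integrableOn_one_div_mul_log_sq ha).const_mul K)
    (Measurable.aestronglyMeasurable ?_) ?_
  · exact ((measurable_id.mul (measurable_log.pow_const 2)).const_div 1).mul
      measurable_primeLogError
  · filter_upwards [ae_restrict_mem measurableSet_Ioi] with x hx
    exact hbound x (ha.trans hx).le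

theorem exists_abs_integral_Ioi_primeLogError_le :
    ∃ K, 0 < K ∧ ∀ a, 1 < a →
      |∫ x in Set.Ioi a, 1 / (x * log x ^ 2) * primeLogError x| ≤ K / log a := by
  obtain ⟨K, hK, hbound⟩ := exists_norm_one_div_mul_log_sq_mul_primeLogError_le
  refine ⟨K, hK, fun a ha => ?_⟩
  rw [← Real.norm_eq_abs]
  calc _ ≤ ∫ x in Set.Ioi a, K * (1 / (x * log x ^ 2)) := by
        refine norm_integral_le_of_norm_le ((integrableOn_one_div_mul_log_sq ha).const_mul K) ?_
        filter_upwards [ae_restrict_mem measurableSet_Ioi] with x hx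
        exact hbound x (ha.trans hx).le
    _ = K / log a := by rw [integral_const_mul, integral_Ioi_one_div_mul_log_sq ha, mul_one_div]

theorem sum_primesLE_one_div_eq {N : ℝ} (hN : 2 ≤ N) :
    ∑ p ∈ Nat.primesLE ⌊N⌋₊, 1 / (p : ℝ) =
      log (log N) - log (log 2) + 1 + primeLogError N / log N +
        ∫ x in 2..N, 1 / (x * log x ^ 2) * primeLogError x := by
  have habel := sum_primesLE_mul_log_div_eq_integral_add (f := fun x => (log x)⁻¹)
    (f' := fun x => -(1 / (x * log x ^ 2))) hN
    (fun x hx => by simpa using (hasDerivAt_neg_inv_log (by linarith [hx.1] : 1 < x)).fun_neg)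
    ((continuousOn_one_div_mul_log_pow 2).neg.mono fun x hx => one_lt_two.trans_le hx.1)
  simp only [RCLike.ofReal_real_eq_id, id_eq, neg_mul, intervalIntegral.integral_neg,
    sub_neg_eq_add] at habel
  have hsum : ∑ p ∈ Nat.primesLE ⌊N⌋₊, 1 / (p : ℝ) =
      ∑ p ∈ Nat.primesLE ⌊N⌋₊, (log p)⁻¹ * (log p / p) := sum_congr rfl fun p hp => by
    have : log p ≠ 0 :=
      (log_pos (by exact_mod_cast (Nat.prime_of_mem_primesLE hp).one_lt)).ne'
    field_simp
  have hmain : ∫ x in 2..N, (log x)⁻¹ / x = log (log N) - log (log 2) := by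
    rw [← integral_one_div_mul_log one_lt_two hN]
    simp only [one_mul, mul_inv_rev, div_eq_mul_inv]
  rw [hsum, habel, hmain, inv_mul_cancel₀ (log_pos one_lt_two).ne', inv_mul_eq_div]

theorem exists_abs_sum_primesLE_one_div_sub_le :
    ∃ M K, 0 < K ∧ ∀ N, 2 ≤ N →
      |∑ p ∈ Nat.primesLE ⌊N⌋₊, 1 / (p : ℝ) - log (log N) - M| ≤ K / log N := by
  obtain ⟨K₁, hK₁, herr⟩ := exists_abs_primeLogError_le
  obtain ⟨K₂, hK₂, htail⟩ := exists_abs_integral_Ioi_primeLogError_le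
  refine ⟨1 - log (log 2) + ∫ x in Set.Ioi 2, 1 / (x * log x ^ 2) * primeLogError x,
    K₁ + K₂, by positivity, fun N hN => ?_⟩
  have hN1 : 1 < N := by linarith
  have hsplit := intervalIntegral.integral_interval_add_Ioi
    (integrableOn_one_div_mul_log_sq_mul_primeLogError one_lt_two)
    (integrableOn_one_div_mul_log_sq_mul_primeLogError hN1)
  have hboundary : |primeLogError N / log N| ≤ K₁ / log N := by
    rw [abs_div, abs_of_pos (log_pos hN1)]
    exact div_le_div_of_nonneg_right (herr N hN1.le) (log_pos hN1).le
  rw [sum_primesLE_one_div_eq hN, ← hsplit, add_div]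
  refine le_trans (le_of_eq ?_) ((abs_sub _ _).trans (add_le_add hboundary (htail N hN1)))
  ring_nf

/-! ### Oscillating prime sums and the Dickman exponent -/

/-- The quotient `(exp (i t u) - 1) / u`. At `u = log p` it turns the weight `log p / p` into
`(p ^ (i t) - 1) / p`, and its integral over `0 < u < 1` is the exponent of `dickmanChar`. -/
noncomputable def oscQuot (t u : ℝ) : ℂ := (Complex.exp (Complex.I * t * u) - 1) / u

/-- The derivative of `oscQuot t` away from `0`. -/
noncomputable def oscQuotDeriv (t u : ℝ) : ℂ :=
  Complex.exp (Complex.I * t * u) * (Complex.I * t) / u - oscQuot t u / u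

theorem norm_exp_I_mul_mul (t u : ℝ) : ‖Complex.exp (Complex.I * t * u)‖ = 1 := by
  simpa [mul_assoc] using Complex.norm_exp_I_mul_ofReal (t * u)

theorem norm_exp_I_mul_mul_sub_one_le (t u : ℝ) :
    ‖Complex.exp (Complex.I * t * u) - 1‖ ≤ |t| * |u| := by
  simpa [mul_assoc] using Real.norm_exp_I_mul_ofReal_sub_one_le (x := t * u)

theorem norm_oscQuot_le (t u : ℝ) : ‖oscQuot t u‖ ≤ |t| := by
  rcases eq_or_ne u 0 with rfl | hu
  · simp [oscQuot]
  rw [oscQuot, norm_div, Complex.norm_real, Real.norm_eq_abs, div_le_iff₀ (abs_pos.mpr hu)]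
  exact norm_exp_I_mul_mul_sub_one_le t u

theorem hasDerivAt_oscQuot (t : ℝ) {u : ℝ} (hu : u ≠ 0) :
    HasDerivAt (oscQuot t) (oscQuotDeriv t u) u := by
  have hexp : HasDerivAt (fun v : ℝ => Complex.exp (Complex.I * t * v) - 1)
      (Complex.exp (Complex.I * t * u) * (Complex.I * t)) u := by
    simpa using (((hasDerivAt_id u).ofReal_comp.const_mul (Complex.I * t)).cexp.sub_const 1)
  have hu' : (u : ℂ) ≠ 0 := by exact_mod_cast hu
  refine (hexp.div (hasDerivAt_id u).ofReal_comp hu').congr_deriv ?_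
  rw [oscQuotDeriv, oscQuot, id_eq, Complex.ofReal_one]
  field_simp

theorem hasDerivAt_oscQuot_log (t : ℝ) {x : ℝ} (hx : 1 < x) :
    HasDerivAt (fun y => oscQuot t (log y)) (oscQuotDeriv t (log x) / x) x := by
  have h := (hasDerivAt_oscQuot t (log_pos hx).ne').scomp x
    (hasDerivAt_log (one_pos.trans hx).ne')
  rwa [Complex.real_smul, Complex.ofReal_inv, inv_mul_eq_div] at h

theorem norm_oscQuotDeriv_le (t u : ℝ) : ‖oscQuotDeriv t u‖ ≤ 2 * |t| / |u| := by
  refine (norm_sub_le _ _).trans ?_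
  simp only [norm_div, norm_mul, norm_exp_I_mul_mul, Complex.norm_I, Complex.norm_real,
    Real.norm_eq_abs, one_mul, ← add_div, two_mul]
  gcongr
  exact norm_oscQuot_le t u

theorem measurable_oscQuot (t : ℝ) : Measurable (oscQuot t) := by
  unfold oscQuot
  fun_prop

theorem continuousOn_oscQuot (t : ℝ) : ContinuousOn (oscQuot t) {0}ᶜ := fun _ hu =>
  (hasDerivAt_oscQuot t hu).continuousAt.continuousWithinAt

theorem continuousOn_oscQuotDeriv (t : ℝ) : ContinuousOn (oscQuotDeriv t) {0}ᶜ := by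
  have hne : ∀ u ∈ ({0}ᶜ : Set ℝ), (u : ℂ) ≠ 0 := fun u hu => by exact_mod_cast hu
  refine ContinuousOn.sub ?_ ((continuousOn_oscQuot t).div (by fun_prop) hne)
  exact ContinuousOn.div (by fun_prop) (by fun_prop) hne

theorem intervalIntegrable_oscQuot (t a b : ℝ) : IntervalIntegrable (oscQuot t) volume a b :=
  (intervalIntegrable_const (c := |t|)).mono_fun (measurable_oscQuot t).aestronglyMeasurable
    (.of_forall fun u => by simpa using norm_oscQuot_le t u)

theorem oscQuot_div (t u c : ℝ) : oscQuot (t / c) u = oscQuot t (u / c) / c := by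
  rcases eq_or_ne c 0 with rfl | hc
  · simp [oscQuot]
  have hc' : (c : ℂ) ≠ 0 := by exact_mod_cast hc
  simp only [oscQuot, Complex.ofReal_div, div_div, div_mul_cancel₀ _ hc', mul_div_assoc', mul_assoc,
    div_mul_eq_mul_div]

theorem norm_integral_zero_oscQuot_le (t a : ℝ) : ‖∫ u in 0..a, oscQuot t u‖ ≤ |t| * |a| := by
  simpa using intervalIntegral.norm_integral_le_of_norm_le_const
    fun u (_ : u ∈ Set.uIoc 0 a) => norm_oscQuot_le t u

/-- The exponent of `dickmanChar`: `dickmanChar α lam = exp (α * dickmanExponent lam)`. -/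
noncomputable def dickmanExponent (lam : ℝ) : ℂ := ∫ v in 0..1, oscQuot lam v

theorem integral_oscQuot_log_div {a N : ℝ} (ha : 1 < a) (haN : a ≤ N) (lam : ℝ) :
    ∫ x in a..N, oscQuot (lam / log N) (log x) / x = ∫ v in log a / log N..1, oscQuot lam v := by
  have hlogN : log N ≠ 0 := (log_pos (ha.trans_le haN)).ne'
  have hpos : ∀ x ∈ Set.uIcc a N, 1 < x := fun x hx =>
    ha.trans_le ((Set.uIcc_of_le haN) ▸ hx).1
  have hsubst := intervalIntegral.integral_deriv_smul_comp' (a := a) (b := N)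
    (f := log) (f' := fun x => x⁻¹) (g := oscQuot (lam / log N))
    (fun x hx => hasDerivAt_log (by linarith [hpos x hx]))
    (continuousOn_inv₀.mono fun x hx => (one_pos.trans (hpos x hx)).ne')
    ((continuousOn_oscQuot _).mono (by
      rintro _ ⟨x, hx, rfl⟩
      exact (log_pos (hpos x hx)).ne'))
  calc _ = ∫ x in a..N, x⁻¹ • oscQuot (lam / log N) (log x) :=
        intervalIntegral.integral_congr fun x _ => by
          simp only [Complex.real_smul, Complex.ofReal_inv, div_eq_inv_mul]
    _ = ∫ u in log a..log N, oscQuot lam (u / log N) / log N := by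
        simpa only [Function.comp_apply, oscQuot_div] using hsubst
    _ = _ := by
        rw [intervalIntegral.integral_div, intervalIntegral.integral_comp_div _ hlogN,
          div_self hlogN, Complex.real_smul, mul_div_cancel_left₀ _ (by exact_mod_cast hlogN)]

theorem exists_norm_integral_oscQuotDeriv_mul_primeLogError_le :
    ∃ K, 0 < K ∧ ∀ t b, 2 ≤ b →
      ‖∫ x in 2..b, oscQuotDeriv t (log x) / x * primeLogError x‖ ≤
        K * |t| * (log (log b) - log (log 2)) := by
  obtain ⟨K, hK, herr⟩ := exists_abs_primeLogError_le
  refine ⟨2 * K, by positivity, fun t b hb => ?_⟩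
  rw [← integral_one_div_mul_log one_lt_two hb, ← intervalIntegral.integral_const_mul]
  refine intervalIntegral.norm_integral_le_of_norm_le hb ?_
    ((intervalIntegrable_one_div_mul_log one_lt_two hb).const_mul _)
  filter_upwards with x hx
  have hx1 : 1 < x := one_lt_two.trans hx.1
  have hlog := log_pos hx1
  have hderiv := norm_oscQuotDeriv_le t (log x)
  rw [abs_of_pos hlog] at hderiv
  rw [norm_mul, norm_div, Complex.norm_real, Complex.norm_real,
    Real.norm_of_nonneg (one_pos.trans hx1).le]
  calc _ ≤ 2 * |t| / log x / x * K := by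
        gcongr
        exact herr x hx1.le
    _ = _ := by field_simp

theorem sum_primesLE_exp_sub_one_div (t : ℝ) (n : ℕ) :
    ∑ p ∈ Nat.primesLE n, (Complex.exp (Complex.I * t * log p) - 1) / p =
      ∑ p ∈ Nat.primesLE n, oscQuot t (log p) * (log p / p : ℝ) := sum_congr rfl fun p hp => by
  have hlog : (log p : ℂ) ≠ 0 := by
    exact_mod_cast (log_pos (by exact_mod_cast (Nat.prime_of_mem_primesLE hp).one_lt)).ne'
  rw [oscQuot, Complex.ofReal_div, div_mul_div_cancel₀ hlog, Complex.ofReal_natCast]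

theorem sum_primesLE_exp_sub_one_div_sub_dickmanExponent {N : ℝ} (hN : 2 ≤ N) (lam : ℝ) :
    ∑ p ∈ Nat.primesLE ⌊N⌋₊,
        (Complex.exp (Complex.I * (lam / log N : ℝ) * log p) - 1) / p - dickmanExponent lam =
      oscQuot (lam / log N) (log 2) * log 2 + oscQuot (lam / log N) (log N) * primeLogError N -
        (∫ x in 2..N, oscQuotDeriv (lam / log N) (log x) / x * primeLogError x) -
        ∫ v in 0..log 2 / log N, oscQuot lam v := by
  have hlog : ∀ x ∈ Set.Icc 2 N, log x ≠ 0 := fun x hx => (log_pos (by linarith [hx.1])).ne'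
  have hne : ∀ x ∈ Set.Icc 2 N, x ≠ 0 := fun x hx => by linarith [hx.1]
  have habel := sum_primesLE_mul_log_div_eq_integral_add
    (f := fun x => oscQuot (lam / log N) (log x))
    (f' := fun x => oscQuotDeriv (lam / log N) (log x) / x) hN
    (fun x hx => hasDerivAt_oscQuot_log _ (by linarith [hx.1]))
    (((continuousOn_oscQuotDeriv _).comp (continuousOn_log.mono hne) hlog).div
      (by fun_prop) fun x hx => by exact_mod_cast hne x hx)
  have hsplit := intervalIntegral.integral_add_adjacent_intervals
    (intervalIntegrable_oscQuot lam 0 (log 2 / log N))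
    (intervalIntegrable_oscQuot lam (log 2 / log N) 1)
  rw [sum_primesLE_exp_sub_one_div]
  simp only [Complex.coe_algebraMap] at habel
  rw [habel, integral_oscQuot_log_div one_lt_two hN, dickmanExponent, ← hsplit]
  ring

theorem neg_log_log_two_le : -log (log 2) ≤ 1 := by
  have := one_sub_inv_le_log_of_pos (log_pos one_lt_two)
  have : (log 2)⁻¹ ≤ 2 := inv_le_of_inv_le₀ two_pos (by linarith [log_two_gt_d9])
  linarith

theorem exists_norm_sum_primesLE_exp_sub_one_div_sub_le :
    ∃ K, 0 < K ∧ ∀ᶠ N : ℝ in atTop, ∀ lam : ℝ,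
      ‖∑ p ∈ Nat.primesLE ⌊N⌋₊,
          (Complex.exp (Complex.I * (lam / log N : ℝ) * log p) - 1) / p - dickmanExponent lam‖ ≤
        K * |lam| * (log (log N) / log N) := by
  obtain ⟨K₁, hK₁, herr⟩ := exists_abs_primeLogError_le
  obtain ⟨K₂, hK₂, hint⟩ := exists_norm_integral_oscQuotDeriv_mul_primeLogError_le
  refine ⟨2 + K₁ + K₂ * 2, by positivity, ?_⟩
  filter_upwards [eventually_ge_atTop 2,
    (tendsto_log_atTop.comp tendsto_log_atTop).eventually_ge_atTop 1] with
    N hN (hloglog : 1 ≤ log (log N)) lam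
  have hlog2 : 0 < log 2 := log_pos one_lt_two
  have hlogN : 0 < log N := log_pos (by linarith)
  set t := lam / log N with ht
  have habs : |t| = |lam| / log N := by rw [ht, abs_div, abs_of_pos hlogN]
  have hfirst : ‖oscQuot t (log 2) * log 2‖ ≤ |t| := by
    rw [norm_mul, Complex.norm_real, Real.norm_of_nonneg hlog2.le]
    nlinarith [norm_oscQuot_le t (log 2), log_two_lt_d9, norm_nonneg (oscQuot t (log 2))]
  have hlast : ‖oscQuot t (log N) * primeLogError N‖ ≤ |t| * K₁ := by
    rw [norm_mul, Complex.norm_real]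
    exact mul_le_mul (norm_oscQuot_le _ _) (herr N (by linarith)) (norm_nonneg _) (abs_nonneg _)
  have hstart : ‖∫ v in 0..log 2 / log N, oscQuot lam v‖ ≤ |t| := by
    refine (norm_integral_zero_oscQuot_le lam _).trans ?_
    rw [abs_of_pos (div_pos hlog2 hlogN), habs, mul_div_assoc']
    gcongr
    nlinarith [log_two_lt_d9, abs_nonneg lam]
  rw [sum_primesLE_exp_sub_one_div_sub_dickmanExponent hN]
  calc _ ≤ |t| + |t| * K₁ + K₂ * |t| * (log (log N) - log (log 2)) + |t| :=
        norm_sub_le_of_le (norm_sub_le_of_le (norm_add_le_of_le hfirst hlast) (hint t N hN)) hstart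
    _ ≤ |t| * log (log N) + |t| * log (log N) * K₁ + K₂ * |t| * (2 * log (log N)) +
          |t| * log (log N) := by
        have : |t| ≤ |t| * log (log N) := le_mul_of_one_le_right (abs_nonneg t) hloglog
        gcongr
        linarith [neg_log_log_two_le]
    _ = _ := by rw [habs]; ring

theorem integral_inv_sq {a b : ℝ} (ha : 0 < a) (hab : a ≤ b) :
    ∫ v in a..b, (v ^ 2)⁻¹ = a⁻¹ - b⁻¹ := by
  have h0 : (0 : ℝ) ∉ Set.uIcc a b := fun h => (ha.trans_le ((Set.uIcc_of_le hab) ▸ h).1).false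
  have h := integral_zpow (n := -2) (.inr ⟨by norm_num, h0⟩)
  norm_num at h
  rw [h]
  ring

theorem integral_exp_div_eq {c a b : ℝ} (hc : c ≠ 0) (ha : 0 < a) (hab : a ≤ b) :
    ∫ v in a..b, Complex.exp (Complex.I * c * v) / v =
      ((b⁻¹ : ℝ) * Complex.exp (Complex.I * c * b) - (a⁻¹ : ℝ) * Complex.exp (Complex.I * c * a) +
        ∫ v in a..b, ((v ^ 2)⁻¹ : ℝ) * Complex.exp (Complex.I * c * v)) / (Complex.I * c) := by
  have hIc : Complex.I * c ≠ 0 := mul_ne_zero Complex.I_ne_zero (by exact_mod_cast hc)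
  have hne : ∀ v ∈ Set.uIcc a b, v ≠ 0 := fun v hv =>
    (ha.trans_le ((Set.uIcc_of_le hab) ▸ hv).1).ne'
  have hderiv : ∀ v ∈ Set.uIcc a b, HasDerivAt
      (fun v : ℝ => Complex.exp (Complex.I * c * v) / (Complex.I * c))
      (Complex.exp (Complex.I * c * v)) v := fun v _ => by
    have h := ((hasDerivAt_id v).ofReal_comp.const_mul (Complex.I * c)).cexp.div_const
      (Complex.I * c)
    simpa only [id_eq, Complex.ofReal_one, mul_one, mul_div_cancel_right₀ _ hIc] using h
  have hparts := intervalIntegral.integral_mul_deriv_eq_deriv_mul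
    (u := fun v => ((v⁻¹ : ℝ) : ℂ)) (u' := fun v => ((-(v ^ 2)⁻¹ : ℝ) : ℂ))
    (fun v hv => (hasDerivAt_inv (hne v hv)).ofReal_comp) hderiv
    (Complex.continuous_ofReal.comp_continuousOn
      ((continuousOn_pow 2).inv₀ fun v hv => pow_ne_zero 2 (hne v hv)).neg).intervalIntegrable
    (by fun_prop : Continuous _).continuousOn.intervalIntegrable
  simp only [Complex.ofReal_neg, neg_mul, intervalIntegral.integral_neg, sub_neg_eq_add,
    mul_div_assoc', intervalIntegral.integral_div, ← sub_div] at hparts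
  rw [← hparts]
  simp only [Complex.ofReal_inv, inv_mul_eq_div]

theorem norm_integral_exp_div_le {c a b : ℝ} (hc : c ≠ 0) (ha : 0 < a) (hab : a ≤ b) :
    ‖∫ v in a..b, Complex.exp (Complex.I * c * v) / v‖ ≤ 2 / (|c| * a) := by
  have hb : 0 < b := ha.trans_le hab
  have hint : ‖∫ v in a..b, ((v ^ 2)⁻¹ : ℝ) * Complex.exp (Complex.I * c * v)‖ ≤ a⁻¹ - b⁻¹ := by
    rw [← integral_inv_sq ha hab]
    refine (intervalIntegral.norm_integral_le_integral_norm hab).trans_eq ?_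
    refine intervalIntegral.integral_congr fun v _ => ?_
    simp only [norm_mul, norm_exp_I_mul_mul, mul_one, Complex.norm_real]
    exact Real.norm_of_nonneg (by positivity)
  have hend : ∀ x : ℝ, 0 < x → ‖((x⁻¹ : ℝ) : ℂ) * Complex.exp (Complex.I * c * x)‖ ≤ x⁻¹ :=
    fun x hx => by
      rw [norm_mul, norm_exp_I_mul_mul, mul_one, Complex.norm_real,
        Real.norm_of_nonneg (inv_pos.mpr hx).le]
  rw [integral_exp_div_eq hc ha hab, norm_div, norm_mul, Complex.norm_I, one_mul,
    Complex.norm_real, Real.norm_eq_abs, mul_comm |c|, ← div_div]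
  gcongr
  calc _ ≤ b⁻¹ + a⁻¹ + (a⁻¹ - b⁻¹) :=
        norm_add_le_of_le (norm_sub_le_of_le (hend b hb) (hend a ha)) hint
    _ = 2 / a := by ring

theorem norm_dickmanExponent_add_log_abs_le {lam : ℝ} (hlam : 1 ≤ |lam|) :
    ‖dickmanExponent lam + log |lam|‖ ≤ 3 := by
  have hpos : 0 < |lam| := one_pos.trans_le hlam
  have hinv : 0 < |lam|⁻¹ := inv_pos.mpr hpos
  have hne : ∀ v ∈ Set.uIcc |lam|⁻¹ 1, (v : ℂ) ≠ 0 := fun v hv => by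
    rw [Set.uIcc_of_le (inv_le_one_of_one_le₀ hlam)] at hv
    exact_mod_cast (hinv.trans_le hv.1).ne'
  have hlog : ∫ v in |lam|⁻¹..1, (v : ℂ)⁻¹ = log |lam| := by
    simp only [← Complex.ofReal_inv, intervalIntegral.integral_ofReal,
      integral_inv_of_pos hinv one_pos, one_div, inv_inv]
  have hinvint : IntervalIntegrable (fun v : ℝ => (v : ℂ)⁻¹) volume |lam|⁻¹ 1 :=
    (ContinuousOn.inv₀ (by fun_prop) hne).intervalIntegrable
  have hsplit : dickmanExponent lam + log |lam| = (∫ v in 0..|lam|⁻¹, oscQuot lam v) +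
      ∫ v in |lam|⁻¹..1, Complex.exp (Complex.I * lam * v) / v := by
    rw [dickmanExponent, ← intervalIntegral.integral_add_adjacent_intervals
      (intervalIntegrable_oscQuot lam 0 |lam|⁻¹) (intervalIntegrable_oscQuot lam |lam|⁻¹ 1),
      add_assoc, ← hlog, ← intervalIntegral.integral_add (intervalIntegrable_oscQuot _ _ _)
        hinvint]
    simp only [oscQuot, sub_div, one_div, sub_add_cancel]
  rw [hsplit]
  calc _ ≤ |lam| * |(|lam|⁻¹)| + 2 / (|lam| * |lam|⁻¹) :=
        norm_add_le_of_le (norm_integral_zero_oscQuot_le lam _)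
          (norm_integral_exp_div_le (abs_pos.mp hpos) hinv (inv_le_one_of_one_le₀ hlam))
    _ = 3 := by
        rw [abs_of_pos hinv, mul_inv_cancel₀ hpos.ne']
        norm_num

theorem norm_dickmanExponent_add_log_le (lam : ℝ) :
    ‖dickmanExponent lam + log (1 + |lam|)‖ ≤ 4 := by
  rcases le_total |lam| 1 with hlam | hlam
  · have hlog : ‖(log (1 + |lam|) : ℂ)‖ ≤ 1 := by
      rw [Complex.norm_real, Real.norm_of_nonneg (log_nonneg (by linarith [abs_nonneg lam]))]
      linarith [log_le_sub_one_of_pos (by positivity : 0 < 1 + |lam|)]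
    have hexponent : ‖dickmanExponent lam‖ ≤ 1 :=
      (norm_integral_zero_oscQuot_le lam 1).trans (by simpa using hlam)
    exact (norm_add_le_of_le hexponent hlog).trans (by norm_num)
  · have hpos : 0 < |lam| := one_pos.trans_le hlam
    have hlog : ‖((log (1 + |lam|) - log |lam| : ℝ) : ℂ)‖ ≤ 1 := by
      rw [Complex.norm_real, ← log_div (by positivity) hpos.ne', Real.norm_of_nonneg
        (log_nonneg ((one_le_div hpos).mpr (by linarith)))]
      refine (log_le_sub_one_of_pos (by positivity)).trans ?_
      rw [add_div, div_self hpos.ne', add_sub_cancel_right]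
      exact (div_le_one hpos).mpr hlam
    calc _ = ‖(dickmanExponent lam + log |lam|) + ((log (1 + |lam|) - log |lam| : ℝ) : ℂ)‖ := by
          push_cast
          ring_nf
      _ ≤ 3 + 1 := norm_add_le_of_le (norm_dickmanExponent_add_log_abs_le hlam) hlog
      _ = 4 := by norm_num

theorem dickmanChar_eq_exp (α : ℂ) (lam : ℝ) :
    dickmanChar α lam = Complex.exp (α * dickmanExponent lam) := rfl

theorem norm_dickmanChar_le (α : ℂ) (lam : ℝ) :
    ‖dickmanChar α lam‖ ≤ exp (4 * ‖α‖) * (1 + |lam|) ^ (-α.re) := by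
  have hre : (α * dickmanExponent lam).re = (α * (dickmanExponent lam + log (1 + |lam|))).re -
      α.re * log (1 + |lam|) := by
    simp [mul_add]
  have hbound : (α * (dickmanExponent lam + log (1 + |lam|))).re ≤ 4 * ‖α‖ := by
    refine (Complex.re_le_norm _).trans ?_
    rw [norm_mul, mul_comm]
    exact mul_le_mul_of_nonneg_right (norm_dickmanExponent_add_log_le lam) (norm_nonneg α)
  rw [dickmanChar_eq_exp, Complex.norm_exp, hre, rpow_def_of_pos (by positivity), ← exp_add]
  gcongr
  linarith

theorem continuous_dickmanExponent : Continuous dickmanExponent :=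
  continuous_iff_continuousAt.mpr fun lam =>
    intervalIntegral.continuousAt_of_dominated_interval (bound := fun _ => |lam| + 1)
      (.of_forall fun mu => (measurable_oscQuot mu).aestronglyMeasurable)
      (by
        filter_upwards [continuous_abs.continuousAt.eventually_lt_const (lt_add_one |lam|)]
          with mu hmu
        exact .of_forall fun v _ => (norm_oscQuot_le mu v).trans hmu.le)
      intervalIntegrable_const
      (.of_forall fun v _ => by unfold oscQuot; fun_prop)

theorem continuous_dickmanChar (α : ℂ) : Continuous (dickmanChar α) :=
  Complex.continuous_exp.comp (continuous_const.mul continuous_dickmanExponent)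

/-! ### Euler products -/

/-- The local factor `1 + w + ⋯ + w ^ (k - 1)` is `exp (w + localLog k w)`; the point of splitting
off `w` is that `localLog k w` is of second order. -/
noncomputable def localLog (k : ℕ) (w : ℂ) : ℂ :=
  Complex.log (1 - w ^ k) - Complex.log (1 - w) - w

theorem one_sub_mem_slitPlane {w : ℂ} (hw : ‖w‖ < 1) : 1 - w ∈ Complex.slitPlane := by
  simpa only [sub_eq_add_neg] using
    Complex.mem_slitPlane_of_norm_lt_one (z := -w) (by rwa [norm_neg])

theorem norm_pow_lt_one {k : ℕ} (hk : k ≠ 0) {w : ℂ} (hw : ‖w‖ < 1) : ‖w ^ k‖ < 1 := by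
  rw [norm_pow]
  exact pow_lt_one₀ (norm_nonneg w) hw hk

theorem exp_add_localLog {k : ℕ} (hk : k ≠ 0) {w : ℂ} (hw : ‖w‖ < 1) :
    Complex.exp (w + localLog k w) = ∑ j ∈ range k, w ^ j := by
  have hne : 1 - w ≠ 0 := Complex.slitPlane_ne_zero (one_sub_mem_slitPlane hw)
  have hne' : 1 - w ^ k ≠ 0 :=
    Complex.slitPlane_ne_zero (one_sub_mem_slitPlane (norm_pow_lt_one hk hw))
  rw [localLog, add_sub_cancel, Complex.exp_sub, Complex.exp_log hne', Complex.exp_log hne,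
    div_eq_iff hne, geom_sum_mul_neg]

theorem localLog_zero {k : ℕ} (hk : k ≠ 0) : localLog k 0 = 0 := by
  simp [localLog, hk]

theorem hasDerivAt_localLog {k : ℕ} (hk : k ≠ 0) {w : ℂ} (hw : ‖w‖ < 1) :
    HasDerivAt (localLog k) (w / (1 - w) - k * w ^ (k - 1) / (1 - w ^ k)) w := by
  have hne : 1 - w ≠ 0 := Complex.slitPlane_ne_zero (one_sub_mem_slitPlane hw)
  refine (((((hasDerivAt_pow k w).const_sub 1).clog
    (one_sub_mem_slitPlane (norm_pow_lt_one hk hw))).sub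
    (((hasDerivAt_id w).const_sub 1).clog (one_sub_mem_slitPlane hw))).sub
    (hasDerivAt_id w)).congr_deriv ?_
  rw [id_eq]
  field_simp
  ring

theorem norm_deriv_localLog_le {k : ℕ} (hk : 2 ≤ k) {ρ s : ℝ} (hρ : ρ < 1) (hs : s ≤ ρ) {w : ℂ}
    (hw : ‖w‖ ≤ s) :
    ‖w / (1 - w) - k * w ^ (k - 1) / (1 - w ^ k)‖ ≤ (k + 1) / (1 - ρ) * s := by
  have hs0 : 0 ≤ s := (norm_nonneg w).trans hw
  have hpow : ∀ j ≠ 0, ‖w ^ j‖ ≤ s := fun j hj => by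
    rw [norm_pow]
    exact (pow_le_of_le_one (norm_nonneg w) (by linarith) hj).trans hw
  have hden : ∀ j ≠ 0, 1 - ρ ≤ ‖1 - w ^ j‖ := fun j hj => by
    have h := norm_sub_norm_le (1 : ℂ) (w ^ j)
    rw [norm_one] at h
    linarith [hpow j hj]
  have hlinear : ‖w / (1 - w)‖ ≤ s / (1 - ρ) := by
    rw [norm_div]
    gcongr
    simpa only [pow_one] using hden 1 one_ne_zero
  have hpower : ‖k * w ^ (k - 1) / (1 - w ^ k)‖ ≤ k * s / (1 - ρ) := by
    rw [norm_div, norm_mul, Complex.norm_natCast]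
    gcongr
    exacts [hpow _ (by omega), hden k (by omega)]
  calc _ ≤ s / (1 - ρ) + k * s / (1 - ρ) := norm_sub_le_of_le hlinear hpower
    _ = (k + 1) / (1 - ρ) * s := by ring

theorem norm_localLog_sub_le {k : ℕ} (hk : 2 ≤ k) {ρ s : ℝ} (hρ : ρ < 1) (hs : s ≤ ρ) {w z : ℂ}
    (hw : ‖w‖ ≤ s) (hz : ‖z‖ ≤ s) :
    ‖localLog k w - localLog k z‖ ≤ (k + 1) / (1 - ρ) * s * ‖w - z‖ := by
  have hball : ∀ x ∈ Metric.closedBall (0 : ℂ) s, ‖x‖ ≤ s := fun x => mem_closedBall_zero_iff.mp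
  exact (convex_closedBall (0 : ℂ) s).norm_image_sub_le_of_norm_hasDerivWithin_le
    (fun x hx => (hasDerivAt_localLog (by omega)
      ((hball x hx).trans_lt (hs.trans_lt hρ))).hasDerivWithinAt)
    (fun x hx => norm_deriv_localLog_le hk hρ hs (hball x hx))
    (mem_closedBall_zero_iff.mpr hz) (mem_closedBall_zero_iff.mpr hw)

theorem norm_localLog_le {k : ℕ} (hk : 2 ≤ k) {ρ : ℝ} (hρ : ρ < 1) {w : ℂ} (hw : ‖w‖ ≤ ρ) :
    ‖localLog k w‖ ≤ (k + 1) / (1 - ρ) * ‖w‖ ^ 2 := by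
  have h := norm_localLog_sub_le hk hρ hw le_rfl (z := 0) (by simp)
  rwa [localLog_zero (by omega), sub_zero, sub_zero, mul_assoc, ← sq] at h

/-- The weight `α p ^ (it) / p` of the prime `p`. -/
noncomputable def primeWeight (α : ℂ) (t : ℝ) (p : ℕ) : ℂ :=
  α / p * Complex.exp (Complex.I * t * log p)

theorem norm_primeWeight (α : ℂ) (t : ℝ) (p : ℕ) : ‖primeWeight α t p‖ = ‖α‖ / p := by
  rw [primeWeight, norm_mul, norm_exp_I_mul_mul, norm_div, Complex.norm_natCast, mul_one]

theorem norm_primeWeight_le (α : ℂ) (t : ℝ) {p : ℕ} (hp : p.Prime) :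
    ‖primeWeight α t p‖ ≤ ‖α‖ / 2 := by
  rw [norm_primeWeight]
  gcongr
  exact_mod_cast hp.two_le

theorem norm_primeWeight_sub_zero_le (α : ℂ) (t : ℝ) (p : ℕ) :
    ‖primeWeight α t p - primeWeight α 0 p‖ ≤ ‖α‖ / p * (|t| * log p) := by
  have hsub : primeWeight α t p - primeWeight α 0 p =
      α / p * (Complex.exp (Complex.I * t * log p) - 1) := by
    simp only [primeWeight, Complex.ofReal_zero, mul_zero, zero_mul, Complex.exp_zero]
    ring
  rw [hsub, norm_mul, norm_div, Complex.norm_natCast]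
  gcongr
  exact (norm_exp_I_mul_mul_sub_one_le t (log p)).trans_eq
    (by rw [abs_of_nonneg (log_natCast_nonneg p)])

section LocalLog

variable {k : ℕ} {α : ℂ}

theorem norm_localLog_primeWeight_le (hk : 2 ≤ k) (hα : ‖α‖ < 2) (t : ℝ) {p : ℕ}
    (hp : p.Prime) :
    ‖localLog k (primeWeight α t p)‖ ≤ (k + 1) / (1 - ‖α‖ / 2) * ‖α‖ ^ 2 / p ^ 2 := by
  refine (norm_localLog_le hk (by linarith) (norm_primeWeight_le α t hp)).trans_eq ?_
  rw [norm_primeWeight, div_pow, mul_div_assoc]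

theorem norm_localLog_primeWeight_sub_zero_le (hk : 2 ≤ k) (hα : ‖α‖ < 2) (t : ℝ) {p : ℕ}
    (hp : p.Prime) :
    ‖localLog k (primeWeight α t p) - localLog k (primeWeight α 0 p)‖ ≤
      (k + 1) / (1 - ‖α‖ / 2) * ‖α‖ ^ 2 * |t| * (log p / p ^ 2) := by
  have hρ : ‖α‖ / 2 < 1 := by linarith
  have hs : ‖α‖ / p ≤ ‖α‖ / 2 := norm_primeWeight α t p ▸ norm_primeWeight_le α t hp
  have hκ : 0 ≤ (k + 1) / (1 - ‖α‖ / 2) := div_nonneg (by positivity) (by linarith)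
  calc _ ≤ (k + 1) / (1 - ‖α‖ / 2) * (‖α‖ / p) * (‖α‖ / p * (|t| * log p)) := by
        refine (norm_localLog_sub_le hk hρ hs (norm_primeWeight α t p).le
          (norm_primeWeight α 0 p).le).trans ?_
        gcongr
        exact norm_primeWeight_sub_zero_le α t p
    _ = _ := by ring

end LocalLog

theorem summable_log_div_sq : Summable fun n : ℕ => log n / (n : ℝ) ^ 2 := by
  simpa only [rpow_two] using summable_log_div_rpow one_lt_two

theorem exists_norm_sum_primesLE_sub_le {E : Type*} [NormedAddCommGroup E] [CompleteSpace E]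
    {g : ℕ → E} {K : ℝ} (hg : ∀ p : ℕ, p.Prime → ‖g p‖ ≤ K / p ^ 2) :
    ∃ S, ∀ N : ℝ, 1 < N → ‖∑ p ∈ Nat.primesLE ⌊N⌋₊, g p - S‖ ≤
      K * (∑' n : ℕ, log n / (n : ℝ) ^ 2) / log N := by
  have hK : 0 ≤ K := by
    have := (norm_nonneg _).trans (hg 2 Nat.prime_two)
    push_cast at this
    linarith
  set G : ℕ → E := {p | p.Prime}.indicator g
  have hG : ∀ n : ℕ, ‖G n‖ ≤ K / n ^ 2 := fun n => by
    rw [norm_indicator_eq_indicator_norm]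
    exact Set.indicator_le' (fun p hp => hg p hp) (fun p _ => by positivity) n
  have hsum : Summable G := Summable.of_norm_bounded
    ((summable_one_div_nat_pow.mpr one_lt_two).mul_left K) fun n => by simpa using! hG n
  refine ⟨∑' n, G n, fun N hN => ?_⟩
  have hlog : 0 < log N := log_pos hN
  have hprimes : ∑ p ∈ Nat.primesLE ⌊N⌋₊, g p = ∑ n ∈ range (⌊N⌋₊ + 1), G n := by
    rw [Nat.primesLE_eq_filter_range, sum_filter]
    simp only [G, Set.indicator_apply, Set.mem_ofPred_eq]
  have htail : ∀ n : ℕ, ‖G (n + (⌊N⌋₊ + 1))‖ ≤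
      K / log N * (log (n + (⌊N⌋₊ + 1) : ℕ) / ((n + (⌊N⌋₊ + 1) : ℕ) : ℝ) ^ 2) := fun n => by
    set m := n + (⌊N⌋₊ + 1) with hm
    have hNm : N ≤ m := (Nat.lt_floor_add_one N).le.trans (by rw [hm]; push_cast; linarith)
    calc _ ≤ K / m ^ 2 * (log m / log N) := (hG m).trans (le_mul_of_one_le_right (by positivity)
          ((one_le_div hlog).mpr (log_le_log (by linarith) hNm)))
      _ = _ := by ring
  rw [hprimes, ← hsum.sum_add_tsum_nat_add (⌊N⌋₊ + 1), sub_add_cancel_left, norm_neg]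
  refine (tsum_of_norm_bounded (((summable_nat_add_iff _).mpr summable_log_div_sq).hasSum.mul_left
    (K / log N)) htail).trans ?_
  rw [mul_div_right_comm]
  exact mul_le_mul_of_nonneg_left (tsum_comp_le_tsum_of_inj summable_log_div_sq
    (fun _ => by positivity) (add_left_injective _)) (by positivity)

/-- The Euler product of `∑ α ^ Ω(n) n ^ (it) / n` over the `k`-free `N`-smooth numbers. -/
noncomputable def eulerProd (k : ℕ) (α : ℂ) (N t : ℝ) : ℂ :=
  ∏ p ∈ Nat.primesLE ⌊N⌋₊, ∑ j ∈ range k, primeWeight α t p ^ j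

theorem continuous_eulerProd (k : ℕ) (α : ℂ) (N : ℝ) : Continuous (eulerProd k α N) := by
  unfold eulerProd primeWeight
  fun_prop

theorem exists_sum_primesLE_one_div_le :
    ∃ K, ∀ N : ℝ, 2 ≤ N → ∑ p ∈ Nat.primesLE ⌊N⌋₊, 1 / (p : ℝ) ≤ log (log N) + K := by
  obtain ⟨M, K, hK, hmertens⟩ := exists_abs_sum_primesLE_one_div_sub_le
  refine ⟨M + K / log 2, fun N hN => ?_⟩
  have hlog2 : 0 < log 2 := log_pos one_lt_two
  have hKN : K / log N ≤ K / log 2 := by gcongr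
  linarith [(le_abs_self _).trans (hmertens N hN)]

section EulerProduct

variable {k : ℕ} {α : ℂ}

theorem eulerProd_eq_exp (hk : k ≠ 0) (hα : ‖α‖ < 2) (N t : ℝ) :
    eulerProd k α N t = Complex.exp
      (∑ p ∈ Nat.primesLE ⌊N⌋₊, (primeWeight α t p + localLog k (primeWeight α t p))) := by
  rw [eulerProd, Complex.exp_sum]
  refine prod_congr rfl fun p hp => (exp_add_localLog hk ?_).symm
  linarith [norm_primeWeight_le α t (Nat.prime_of_mem_primesLE hp)]

theorem exists_norm_eulerProd_le (hk : 2 ≤ k) (hα : ‖α‖ < 2) :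
    ∃ K, 0 < K ∧ ∀ N : ℝ, 2 ≤ N → ∀ t, ‖eulerProd k α N t‖ ≤ K * log N ^ ‖α‖ := by
  obtain ⟨K, hK⟩ := exists_sum_primesLE_one_div_le
  set κ := (k + 1) / (1 - ‖α‖ / 2) * ‖α‖ ^ 2
  have hκ : 0 ≤ κ := mul_nonneg (div_nonneg (by positivity) (by linarith)) (sq_nonneg _)
  have hsq : Summable fun n : ℕ => κ / (n : ℝ) ^ 2 := by
    simpa only [mul_one_div] using (summable_one_div_nat_pow.mpr one_lt_two).mul_left κ
  refine ⟨exp (‖α‖ * K + ∑' n : ℕ, κ / (n : ℝ) ^ 2), exp_pos _, fun N hN t => ?_⟩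
  rw [eulerProd_eq_exp (by omega) hα, rpow_def_of_pos (log_pos (by linarith)), ← exp_add]
  refine (Complex.norm_exp_le_exp_norm _).trans (exp_le_exp.mpr ?_)
  calc _ ≤ ∑ p ∈ Nat.primesLE ⌊N⌋₊, (‖α‖ * (1 / p) + κ / (p : ℝ) ^ 2) :=
        norm_sum_le_of_le _ fun p hp => norm_add_le_of_le
          ((norm_primeWeight α t p).trans (div_eq_mul_one_div _ _)).le
          (norm_localLog_primeWeight_le hk hα t (Nat.prime_of_mem_primesLE hp))
    _ = ‖α‖ * ∑ p ∈ Nat.primesLE ⌊N⌋₊, 1 / (p : ℝ) + ∑ p ∈ Nat.primesLE ⌊N⌋₊, κ / (p : ℝ) ^ 2 := by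
        rw [sum_add_distrib, mul_sum]
    _ ≤ ‖α‖ * (log (log N) + K) + ∑' n : ℕ, κ / (n : ℝ) ^ 2 := by
        gcongr
        exacts [hK N hN, hsq.sum_le_tsum _ fun n _ => by positivity]
    _ = _ := by ring

theorem sum_primeWeight_eq (α : ℂ) (t : ℝ) (n : ℕ) :
    ∑ p ∈ Nat.primesLE n, primeWeight α t p = α * ((∑ p ∈ Nat.primesLE n, 1 / (p : ℝ) : ℝ) +
      ∑ p ∈ Nat.primesLE n, (Complex.exp (Complex.I * t * log p) - 1) / p) := by
  rw [Complex.ofReal_sum, ← sum_add_distrib, mul_sum]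
  refine sum_congr rfl fun p _ => ?_
  rw [primeWeight, Complex.ofReal_div, Complex.ofReal_one, Complex.ofReal_natCast]
  ring

theorem exists_norm_sum_primeWeight_sub_le (α : ℂ) :
    ∃ (M : ℂ) (K : ℝ), 0 < K ∧ ∀ᶠ N : ℝ in atTop, ∀ lam : ℝ,
      ‖∑ p ∈ Nat.primesLE ⌊N⌋₊, primeWeight α (lam / log N) p -
          (α * log (log N) + α * dickmanExponent lam + M)‖ ≤
        K * (1 + |lam|) * (log (log N) / log N) := by
  obtain ⟨M, K₁, hK₁, hmertens⟩ := exists_abs_sum_primesLE_one_div_sub_le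
  obtain ⟨K₂, hK₂, hosc⟩ := exists_norm_sum_primesLE_exp_sub_one_div_sub_le
  refine ⟨α * M, (‖α‖ + 1) * (K₁ + K₂), by positivity, ?_⟩
  filter_upwards [hosc, eventually_ge_atTop 2,
    (tendsto_log_atTop.comp tendsto_log_atTop).eventually_ge_atTop 1] with N hoscN hN hloglog lam
  have hlog : 0 < log N := log_pos (by linarith)
  replace hloglog : 1 ≤ log (log N) := hloglog
  set X := log (log N) / log N with hX
  have hmertensN : ‖((∑ p ∈ Nat.primesLE ⌊N⌋₊, 1 / (p : ℝ) - log (log N) - M : ℝ) : ℂ)‖ ≤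
      K₁ * X := by
    rw [Complex.norm_real]
    refine (hmertens N hN).trans ?_
    rw [hX, mul_div_assoc']
    gcongr
    exact le_mul_of_one_le_right hK₁.le hloglog
  calc _ = ‖α * (((∑ p ∈ Nat.primesLE ⌊N⌋₊, 1 / (p : ℝ) - log (log N) - M : ℝ) : ℂ) +
          (∑ p ∈ Nat.primesLE ⌊N⌋₊, (Complex.exp (Complex.I * (lam / log N : ℝ) * log p) - 1) / p -
            dickmanExponent lam))‖ := by
        rw [sum_primeWeight_eq]
        congr 1
        push_cast
        ring
    _ ≤ ‖α‖ * (K₁ * X + K₂ * |lam| * X) := by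
        rw [norm_mul]
        gcongr
        exact norm_add_le_of_le hmertensN (hoscN lam)
    _ ≤ (‖α‖ + 1) * (K₁ * (1 + |lam|) * X + K₂ * (1 + |lam|) * X) := by
        gcongr
        · linarith
        · exact le_mul_of_one_le_right hK₁.le (by linarith [abs_nonneg lam])
        · linarith
    _ = _ := by ring

theorem exists_norm_sum_localLog_primeWeight_sub_le (hk : 2 ≤ k) (hα : ‖α‖ < 2) :
    ∃ (S : ℂ) (K : ℝ), 0 < K ∧ ∀ N : ℝ, 1 < N → ∀ lam : ℝ,
      ‖∑ p ∈ Nat.primesLE ⌊N⌋₊, localLog k (primeWeight α (lam / log N) p) - S‖ ≤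
        K * (1 + |lam|) / log N := by
  obtain ⟨S, hS⟩ := exists_norm_sum_primesLE_sub_le fun p hp =>
    norm_localLog_primeWeight_le hk hα 0 hp
  set κ := (k + 1) / (1 - ‖α‖ / 2) * ‖α‖ ^ 2
  have hκ : 0 ≤ κ := mul_nonneg (div_nonneg (by positivity) (by linarith)) (sq_nonneg _)
  set T := ∑' n : ℕ, log n / (n : ℝ) ^ 2
  have hT : 0 ≤ T := tsum_nonneg fun n => by positivity
  refine ⟨S, κ * T + 1, by positivity, fun N hN lam => ?_⟩
  have hlog : 0 < log N := log_pos hN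
  have hshift : ‖∑ p ∈ Nat.primesLE ⌊N⌋₊, localLog k (primeWeight α (lam / log N) p) -
      ∑ p ∈ Nat.primesLE ⌊N⌋₊, localLog k (primeWeight α 0 p)‖ ≤ κ * |lam / log N| * T := by
    rw [← sum_sub_distrib]
    refine (norm_sum_le_of_le _ fun p hp => norm_localLog_primeWeight_sub_zero_le hk hα _
      (Nat.prime_of_mem_primesLE hp)).trans ?_
    rw [← mul_sum]
    gcongr
    exact summable_log_div_sq.sum_le_tsum _ fun n _ => by positivity
  calc _ ≤ κ * |lam / log N| * T + κ * T / log N :=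
        (norm_sub_le_norm_sub_add_norm_sub _ _ _).trans (add_le_add hshift (hS N hN))
    _ = κ * T * (1 + |lam|) / log N := by
        rw [abs_div, abs_of_pos hlog]
        ring
    _ ≤ _ := by
        gcongr
        linarith

end EulerProduct

/-- No prime occurs in `n` to the power `k`, that is, `n` is `k`-free. -/
def IsPowFree (k n : ℕ) : Prop := ∀ p : ℕ, p.Prime → ¬ p ^ k ∣ n

theorem isPowFree_one {k : ℕ} (hk : k ≠ 0) : IsPowFree k 1 := fun _ hp hdvd =>
  hp.one_lt.ne' ((Nat.pow_eq_one.mp (Nat.dvd_one.mp hdvd)).resolve_right hk)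

theorem isPowFree_prime_pow_iff {k : ℕ} (hk : k ≠ 0) {q j : ℕ} (hq : q.Prime) :
    IsPowFree k (q ^ j) ↔ j < k := by
  refine ⟨fun h => ?_, fun hjk p hp hdvd => ?_⟩
  · by_contra! hkj
    exact h q hq (pow_dvd_pow q hkj)
  · have hpq : p = q := (Nat.prime_dvd_prime_iff_eq hp hq).mp
      (hp.dvd_of_dvd_pow ((dvd_pow_self p hk).trans hdvd))
    rw [hpq, Nat.pow_dvd_pow_iff_le_right hq.one_lt] at hdvd
    omega

theorem isPowFree_mul_iff {k : ℕ} (hk : k ≠ 0) {m n : ℕ} (hmn : m.Coprime n) :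
    IsPowFree k (m * n) ↔ IsPowFree k m ∧ IsPowFree k n := by
  simp only [IsPowFree, ← forall_and]
  refine forall₂_congr fun p hp => ?_
  rw [hmn.isPrimePow_dvd_mul (hp.isPrimePow.pow hk), not_or]

theorem smoothKFree_eq (k : ℕ) (N : ℝ) :
    smoothKFree k N = Nat.smoothNumbers (⌊N⌋₊ + 1) ∩ {n | IsPowFree k n} := by
  ext n
  rw [Set.inter_comm]
  refine and_congr_right fun hfree => ?_
  have hn : n ≠ 0 := by
    rintro rfl
    exact hfree 2 Nat.prime_two (dvd_zero _)
  simp only [Nat.mem_smoothNumbers, hn, ne_eq, not_false_eq_true, true_and,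
    Nat.mem_primeFactorsList hn, and_imp]
  exact forall₂_congr fun p hp => imp_congr_right fun _ => by
    rw [Nat.lt_succ_iff, Nat.le_floor_iff' hp.ne_zero]

/-- The summand `α ^ Ω(n) n ^ (it) / n`, whose value at a prime is `primeWeight`. -/
noncomputable def omegaTerm (α : ℂ) (t : ℝ) (n : ℕ) : ℂ :=
  Complex.exp (Complex.I * t * log n) * (α ^ ArithmeticFunction.cardFactors n / n)

theorem omegaTerm_zero (α : ℂ) (t : ℝ) : omegaTerm α t 0 = 0 := by simp [omegaTerm]

theorem omegaTerm_one (α : ℂ) (t : ℝ) : omegaTerm α t 1 = 1 := by simp [omegaTerm]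

theorem omegaTerm_mul (α : ℂ) (t : ℝ) (m n : ℕ) :
    omegaTerm α t (m * n) = omegaTerm α t m * omegaTerm α t n := by
  rcases eq_or_ne m 0 with rfl | hm
  · rw [zero_mul, omegaTerm_zero, zero_mul]
  rcases eq_or_ne n 0 with rfl | hn
  · rw [mul_zero, omegaTerm_zero, mul_zero]
  have hlog : log ((m * n : ℕ) : ℝ) = log m + log n := by
    rw [Nat.cast_mul, log_mul (by exact_mod_cast hm) (by exact_mod_cast hn)]
  rw [omegaTerm, omegaTerm, omegaTerm, hlog, ArithmeticFunction.cardFactors_mul hm hn,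
    Complex.ofReal_add, mul_add, Complex.exp_add, pow_add, Nat.cast_mul, mul_div_mul_comm]
  ring

theorem omegaTerm_pow (α : ℂ) (t : ℝ) (n j : ℕ) : omegaTerm α t (n ^ j) = omegaTerm α t n ^ j := by
  induction j with
  | zero => rw [pow_zero, pow_zero, omegaTerm_one]
  | succ j ih => rw [pow_succ, pow_succ, omegaTerm_mul, ih]

theorem omegaTerm_prime (α : ℂ) (t : ℝ) {p : ℕ} (hp : p.Prime) :
    omegaTerm α t p = primeWeight α t p := by
  rw [omegaTerm, primeWeight, ArithmeticFunction.cardFactors_apply_prime hp, pow_one, mul_comm]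

/-- The terms `omegaTerm α t n` with `n` ranging over `k`-free numbers only. -/
noncomputable def kFreeTerm (k : ℕ) (α : ℂ) (t : ℝ) : ℕ → ℂ :=
  {n | IsPowFree k n}.indicator (omegaTerm α t)

section KFreeTerm

variable {k : ℕ} (hk : k ≠ 0) (α : ℂ) (t : ℝ)
include hk

theorem kFreeTerm_one : kFreeTerm k α t 1 = 1 := by
  rw [kFreeTerm, Set.indicator_of_mem (isPowFree_one hk), omegaTerm_one]

theorem kFreeTerm_mul {m n : ℕ} (hmn : m.Coprime n) :
    kFreeTerm k α t (m * n) = kFreeTerm k α t m * kFreeTerm k α t n := by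
  classical
  simp only [kFreeTerm, Set.indicator_apply, Set.mem_ofPred_eq, isPowFree_mul_iff hk hmn,
    omegaTerm_mul, ite_zero_mul_ite_zero]

theorem kFreeTerm_prime_pow {p : ℕ} (hp : p.Prime) (j : ℕ) :
    kFreeTerm k α t (p ^ j) = if j < k then primeWeight α t p ^ j else 0 := by
  classical
  simp only [kFreeTerm, Set.indicator_apply, Set.mem_ofPred_eq, isPowFree_prime_pow_iff hk hp,
    omegaTerm_pow, omegaTerm_prime α t hp]

theorem hasSum_kFreeTerm_prime_pow {p : ℕ} (hp : p.Prime) :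
    HasSum (fun j => kFreeTerm k α t (p ^ j)) (∑ j ∈ range k, primeWeight α t p ^ j) := by
  have hsum : ∑ j ∈ range k, primeWeight α t p ^ j = ∑ j ∈ range k, kFreeTerm k α t (p ^ j) :=
    sum_congr rfl fun j hj => by rw [kFreeTerm_prime_pow hk α t hp, if_pos (mem_range.mp hj)]
  rw [hsum]
  exact hasSum_sum_of_ne_finset_zero fun j hj => by
    rw [kFreeTerm_prime_pow hk α t hp, if_neg (by simpa using hj)]

theorem hasSum_kFreeTerm_smoothNumbers (N : ℝ) :
    HasSum (fun n : Nat.smoothNumbers (⌊N⌋₊ + 1) => kFreeTerm k α t n) (eulerProd k α N t) := by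
  have hprod := (EulerProduct.summable_and_hasSum_smoothNumbers_prod_primesBelow_tsum
    (kFreeTerm_one hk α t) (kFreeTerm_mul hk α t)
    (fun hp => (hasSum_kFreeTerm_prime_pow hk α t hp).summable.norm) (⌊N⌋₊ + 1)).2
  have heuler : eulerProd k α N t =
      ∏ p ∈ (⌊N⌋₊ + 1).primesBelow, ∑' j, kFreeTerm k α t (p ^ j) :=
    prod_congr rfl fun p hp =>
      (hasSum_kFreeTerm_prime_pow hk α t (Nat.prime_of_mem_primesLE hp)).tsum_eq.symm
  rwa [heuler]

theorem sum_smoothKFree_omegaTerm (N : ℝ) :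
    ∑ n ∈ (smoothKFree_finite k N).toFinset, omegaTerm α t n = eulerProd k α N t := by
  have hprod : HasSum ((smoothKFree k N).indicator (omegaTerm α t)) (eulerProd k α N t) := by
    rw [smoothKFree_eq, ← Set.indicator_indicator]
    exact hasSum_subtype_iff_indicator.mp (hasSum_kFreeTerm_smoothNumbers hk α t N)
  rw [← Set.Finite.coe_toFinset (smoothKFree_finite k N)] at hprod
  exact ((hasSum_subtype_iff_indicator.mpr hprod).unique (Finset.hasSum _ _)).symm

end KFreeTerm

/-! ### Fourier inversion -/

theorem integral_fourierInv_mul_eq {V : Type*} [NormedAddCommGroup V] [InnerProductSpace ℝ V]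
    [MeasurableSpace V] [BorelSpace V] [FiniteDimensional ℝ V] {f g : V → ℂ} (hf : Integrable f)
    (hg : Integrable g) : ∫ x, 𝓕⁻ f x * g x = ∫ x, f x * 𝓕⁻ g x := by
  have h := VectorFourier.integral_fourierIntegral_smul_eq_flip (L := -innerₗ V)
    Real.continuous_fourierChar (by simpa using! continuous_inner.neg) hf hg
  have hflip : (-innerₗ V).flip = -innerₗ V := by
    ext x y
    simp [real_inner_comm]
  rwa [hflip] at h

theorem continuous_fourierInv {V E : Type*} [NormedAddCommGroup V] [InnerProductSpace ℝ V]
    [MeasurableSpace V] [BorelSpace V] [FiniteDimensional ℝ V] [NormedAddCommGroup E]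
    [NormedSpace ℂ E] {f : V → E} (hf : Integrable f) : Continuous (𝓕⁻ f) :=
  VectorFourier.fourierIntegral_continuous Real.continuous_fourierChar
    (by simpa using! continuous_inner.neg) hf

theorem fourierTransform_eq (f : ℝ → ℂ) (x : ℝ) :
    fourierTransform f x = (2 * π : ℝ)⁻¹ * 𝓕 f (x / (2 * π)) := by
  rw [fourierTransform, Real.fourier_real_eq_integral_exp_smul]
  congr 2
  · simp
  · funext v
    have hphase : -2 * π * v * (x / (2 * π)) = -(x * v) := by field_simp
    rw [hphase, smul_eq_mul]
    push_cast
    ring_nf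

theorem integral_comp_two_pi_mul_eq {f g : ℝ → ℂ} (h : IsFourierTransform f g)
    (χ : SchwartzMap ℝ ℂ) : ∫ y, f (2 * π * y) * χ y = ∫ v, g v * 𝓕⁻ (χ : ℝ → ℂ) v := by
  have hχ : 𝓕 ((𝓕⁻ χ : SchwartzMap ℝ ℂ) : ℝ → ℂ) = χ := by
    rw [← SchwartzMap.fourier_coe, FourierInvPair.fourier_fourierInv_eq]
  have hpi : 2 * π ≠ 0 := by positivity
  rw [← SchwartzMap.fourierInv_coe, (h (𝓕⁻ χ)).2]
  simp only [fourierTransform_eq, hχ]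
  have hscale := Measure.integral_comp_mul_left (fun x => f x * χ (x / (2 * π))) (2 * π)
  simp only [mul_div_cancel_left₀ _ hpi] at hscale
  rw [hscale, abs_of_pos (by positivity), ← integral_smul]
  refine integral_congr_ae (.of_forall fun x => ?_)
  simp only [Complex.real_smul]
  ring

theorem comp_two_pi_mul_eq_fourierInv {f g : ℝ → ℂ} (hf : Continuous f) (hg : Integrable g)
    (h : IsFourierTransform f g) : (fun y => f (2 * π * y)) = 𝓕⁻ g := by
  have hf' : Continuous fun y => f (2 * π * y) := by fun_prop
  have hg' := continuous_fourierInv hg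
  refine (hf'.ae_eq_iff_eq volume hg').mp (ae_eq_of_integral_contDiff_smul_eq
    hf'.locallyIntegrable hg'.locallyIntegrable fun χ hχ hχc => ?_)
  set Χ := (hχc.comp_left (g := fun x : ℝ => (x : ℂ)) Complex.ofReal_zero).toSchwartzMap
    (Complex.ofRealCLM.contDiff.comp hχ)
  calc ∫ y, χ y • f (2 * π * y) = ∫ y, f (2 * π * y) * Χ y :=
        integral_congr_ae (.of_forall fun _ => Complex.real_smul.trans (mul_comm _ _))
    _ = ∫ y, 𝓕⁻ g y * Χ y := by
        rw [integral_comp_two_pi_mul_eq h, integral_fourierInv_mul_eq hg Χ.integrable]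
    _ = ∫ y, χ y • 𝓕⁻ g y :=
        integral_congr_ae (.of_forall fun _ => (mul_comm _ _).trans Complex.real_smul.symm)

theorem eq_integral_of_isFourierTransform {f g : ℝ → ℂ} (hf : Continuous f) (hg : Integrable g)
    (h : IsFourierTransform f g) (x : ℝ) :
    f x = ∫ lam : ℝ, g lam * Complex.exp (Complex.I * lam * x) := by
  have hinv := congrFun (comp_two_pi_mul_eq_fourierInv hf hg h) (x / (2 * π))
  simp only [mul_div_cancel₀ x two_pi_pos.ne', Real.fourierInv_eq'] at hinv
  rw [hinv]
  refine integral_congr_ae (.of_forall fun v => ?_)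
  have hphase : 2 * π * inner ℝ v (x / (2 * π)) = v * x := by
    simp only [RCLike.inner_apply, conj_trivial]
    field_simp
  simp only [hphase, smul_eq_mul]
  push_cast
  ring_nf

theorem aestronglyMeasurable_of_isFourierTransform {f g : ℝ → ℂ} (h : IsFourierTransform f g) :
    AEStronglyMeasurable g volume := by
  have hball : ∀ n : ℕ,
      AEStronglyMeasurable g (volume.restrict (Metric.closedBall (0 : ℝ) (n + 1))) := fun n => by
    let bump : ContDiffBump (0 : ℝ) := ⟨n + 1, n + 2, by positivity, by linarith⟩
    have hsupp : HasCompactSupport fun x => (bump x : ℂ) :=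
      bump.hasCompactSupport.comp_left (g := fun x : ℝ => (x : ℂ)) Complex.ofReal_zero
    have hsmooth : ContDiff ℝ (⊤ : ℕ∞) fun x => (bump x : ℂ) :=
      Complex.ofRealCLM.contDiff.comp bump.contDiff
    have hmeas := (h (hsupp.toSchwartzMap hsmooth)).1.aestronglyMeasurable.restrict
      (s := Metric.closedBall (0 : ℝ) (n + 1))
    refine hmeas.congr ?_
    filter_upwards [ae_restrict_mem Metric.isClosed_closedBall.measurableSet] with x hx
    have hone : bump x = 1 := bump.one_of_mem_closedBall hx
    simp [hone]
  have hcover : ⋃ n : ℕ, Metric.closedBall (0 : ℝ) (n + 1) = Set.univ :=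
    Set.eq_univ_of_forall fun x => by
      obtain ⟨n, hn⟩ := exists_nat_ge ‖x‖
      exact Set.mem_iUnion.mpr ⟨n, mem_closedBall_zero_iff.mpr (by linarith)⟩
  rw [← Measure.restrict_univ (μ := volume), ← hcover]
  exact aestronglyMeasurable_iUnion_iff.mpr hball

/-! ### Truncation of the Fourier integral -/

theorem exists_norm_le_one_add_abs_rpow {η A : ℝ} (hη : 0 ≤ η) (hA : 0 < A) {g : ℝ → ℂ}
    (hg : ∀ lam : ℝ, ‖g lam‖ ≤ A / (1 + |lam| ^ η)) :
    ∃ B, 0 < B ∧ ∀ lam : ℝ, ‖g lam‖ ≤ B * (1 + |lam|) ^ (-η) := by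
  refine ⟨A * 2 ^ η, by positivity, fun lam => (hg lam).trans ?_⟩
  have hpow : (1 + |lam|) ^ η ≤ 2 ^ η * (1 + |lam| ^ η) := by
    have hmax : 1 + |lam| ≤ 2 * max 1 |lam| := by
      linarith [le_max_left 1 |lam|, le_max_right 1 |lam|]
    have hmaxpow : max 1 |lam| ^ η ≤ 1 + |lam| ^ η := by
      rcases max_cases 1 |lam| with ⟨h, _⟩ | ⟨h, _⟩ <;> rw [h]
      · linarith [one_rpow η, rpow_nonneg (abs_nonneg lam) η]
      · linarith
    calc (1 + |lam|) ^ η ≤ (2 * max 1 |lam|) ^ η := by gcongr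
      _ = 2 ^ η * max 1 |lam| ^ η := mul_rpow zero_le_two (by positivity)
      _ ≤ _ := by gcongr
  rw [rpow_neg (by positivity), ← div_eq_mul_inv, div_le_div_iff₀ (by positivity) (by positivity),
    mul_assoc]
  gcongr

theorem continuous_one_add_abs_rpow (s : ℝ) : Continuous fun lam : ℝ => (1 + |lam|) ^ s :=
  (by fun_prop : Continuous fun lam : ℝ => 1 + |lam|).rpow_const fun lam => .inl (by positivity)

theorem integrable_one_add_abs_rpow {η : ℝ} (hη : 1 < η) :
    Integrable fun lam : ℝ => (1 + |lam|) ^ (-η) := by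
  simpa using integrable_one_add_norm (E := ℝ) (μ := volume) (r := η) (by simpa using hη)

theorem measurableSet_abs_le (R : ℝ) : MeasurableSet {lam : ℝ | |lam| ≤ R} :=
  measurableSet_le measurable_norm measurable_const

theorem integrableOn_abs_le_of_continuous {E : Type*} [NormedAddCommGroup E] {f : ℝ → E}
    (hf : Continuous f) (R : ℝ) : IntegrableOn f {lam : ℝ | |lam| ≤ R} := by
  simpa only [abs_le] using! hf.integrableOn_Icc (a := -R) (b := R)

theorem setIntegral_compl_one_add_abs_rpow_le {η R : ℝ} (hη : 1 < η) (hR : 0 < R) :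
    ∫ lam in {lam : ℝ | |lam| ≤ R}ᶜ, (1 + |lam|) ^ (-η) ≤ 2 / (η - 1) * R ^ (1 - η) := by
  have hfold : ∫ lam in {lam : ℝ | |lam| ≤ R}ᶜ, (1 + |lam|) ^ (-η) =
      2 * ∫ x in Set.Ioi R, (1 + x) ^ (-η) := by
    have habs := integral_comp_abs (f := (Set.Ioi R).indicator fun x : ℝ => (1 + x) ^ (-η))
    rw [setIntegral_indicator measurableSet_Ioi,
      Set.inter_eq_right.mpr (Set.Ioi_subset_Ioi hR.le)] at habs
    rw [← habs, ← integral_indicator (measurableSet_abs_le R).compl]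
    refine integral_congr_ae (.of_forall fun lam => ?_)
    simp only [Set.indicator_apply, Set.mem_compl_iff, Set.mem_ofPred_eq, not_le, Set.mem_Ioi]
  have htail : ∫ x in Set.Ioi R, (1 + x) ^ (-η) ≤ ∫ x in Set.Ioi R, x ^ (-η) := by
    refine setIntegral_mono_on ?_ (integrableOn_Ioi_rpow_of_lt (by linarith) hR)
      measurableSet_Ioi fun x hx =>
        rpow_le_rpow_of_nonpos (hR.trans hx) (by linarith) (by linarith)
    refine (integrable_one_add_abs_rpow hη).integrableOn.congr_fun (fun x hx => ?_)
      measurableSet_Ioi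
    simp only [abs_of_pos (hR.trans hx)]
  calc _ ≤ 2 * (-R ^ (-η + 1) / (-η + 1)) := by
        rw [hfold, ← integral_Ioi_rpow_of_lt (by linarith) hR]
        gcongr
    _ = _ := by
        rw [show -η + 1 = -(η - 1) by ring, neg_div_neg_eq, neg_sub]
        ring

theorem norm_integral_sub_setIntegral_le {X E : Type*} [MeasurableSpace X] {μ : Measure X}
    [NormedAddCommGroup E] [NormedSpace ℝ E] {F G : X → E} {a b : X → ℝ} {S : Set X}
    (hS : MeasurableSet S) (hF : Integrable F μ) (hG : IntegrableOn G S μ)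
    (ha : IntegrableOn a S μ) (hb : IntegrableOn b Sᶜ μ) (hFG : ∀ x ∈ S, ‖F x - G x‖ ≤ a x)
    (hFb : ∀ x ∈ Sᶜ, ‖F x‖ ≤ b x) :
    ‖∫ x, F x ∂μ - ∫ x in S, G x ∂μ‖ ≤ ∫ x in S, a x ∂μ + ∫ x in Sᶜ, b x ∂μ := by
  rw [← integral_add_compl hS hF, add_sub_right_comm, ← integral_sub hF.integrableOn hG]
  exact norm_add_le_of_le
    (norm_integral_le_of_norm_le ha (ae_restrict_of_forall_mem hS hFG))
    (norm_integral_le_of_norm_le hb (ae_restrict_of_forall_mem hS.compl hFb))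

theorem norm_integral_mul_sub_mainIntegral_le {α : ℂ} {g Q : ℝ → ℂ} {η B M κ R : ℝ} (hη : 1 < η)
    (hκ : 0 ≤ κ) (hR : 0 < R) (hgm : AEStronglyMeasurable g)
    (hg : ∀ lam, ‖g lam‖ ≤ B * (1 + |lam|) ^ (-η)) (hQ : Continuous Q) (hQM : ∀ lam, ‖Q lam‖ ≤ M)
    (hQφ : ∀ lam, |lam| ≤ R →
      ‖Q lam - dickmanChar α lam‖ ≤ κ * (1 + |lam|) * ‖dickmanChar α lam‖) :
    ‖(∫ lam, g lam * Q lam) - mainIntegral α g R‖ ≤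
      B * exp (4 * ‖α‖) * κ * (∫ lam in {lam : ℝ | |lam| ≤ R}, (1 + |lam|) ^ (-(η + α.re - 1))) +
        B * M * (2 / (η - 1) * R ^ (1 - η)) := by
  have hB : 0 ≤ B := by simpa using (norm_nonneg _).trans (hg 0)
  have hM : 0 ≤ M := (norm_nonneg _).trans (hQM 0)
  have hint : Integrable g :=
    ((integrable_one_add_abs_rpow hη).const_mul B).mono' hgm (.of_forall hg)
  have hφg : IntegrableOn (fun lam => dickmanChar α lam * g lam) {lam : ℝ | |lam| ≤ R} := by
    simp only [abs_le]
    exact hint.integrableOn.continuousOn_mul (continuous_dickmanChar α).continuousOn isCompact_Icc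
  have hnear : ∀ lam, |lam| ≤ R → ‖g lam * Q lam - dickmanChar α lam * g lam‖ ≤
      B * exp (4 * ‖α‖) * κ * (1 + |lam|) ^ (-(η + α.re - 1)) := fun lam hlam => by
    have hpos : 0 < 1 + |lam| := by positivity
    calc _ = ‖g lam‖ * ‖Q lam - dickmanChar α lam‖ := by
          rw [← norm_mul]
          ring_nf
      _ ≤ B * (1 + |lam|) ^ (-η) *
            (κ * (1 + |lam|) * (exp (4 * ‖α‖) * (1 + |lam|) ^ (-α.re))) := by
          refine mul_le_mul (hg lam) ((hQφ lam hlam).trans ?_) (norm_nonneg _) (by positivity)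
          gcongr
          exact norm_dickmanChar_le α lam
      _ = B * exp (4 * ‖α‖) * κ * ((1 + |lam|) ^ (-η) * (1 + |lam|) ^ (-α.re) * (1 + |lam|)) := by
          ring
      _ = _ := by
          rw [← rpow_add hpos, ← rpow_add_one hpos.ne']
          ring_nf
  have hfar : ∀ lam, ‖g lam * Q lam‖ ≤ B * M * (1 + |lam|) ^ (-η) := fun lam => by
    rw [norm_mul, mul_right_comm]
    exact mul_le_mul (hg lam) (hQM lam) (norm_nonneg _) (by positivity)
  calc _ ≤ _ := norm_integral_sub_setIntegral_le (measurableSet_abs_le R)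
        (hint.mul_bdd hQ.aestronglyMeasurable (.of_forall hQM)) hφg
        ((integrableOn_abs_le_of_continuous (continuous_one_add_abs_rpow _) R).const_mul _)
        ((integrable_one_add_abs_rpow hη).integrableOn.const_mul _) hnear fun lam _ => hfar lam
    _ ≤ _ := by
        rw [integral_const_mul, integral_const_mul]
        gcongr
        exact setIntegral_compl_one_add_abs_rpow_le hη hR

theorem smoothSum_eq_integral {k : ℕ} (hk : k ≠ 0) (α : ℂ) {f g : ℝ → ℂ} (hf : Continuous f)
    (hg : Integrable g) (h : IsFourierTransform f g) (N : ℝ) :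
    smoothSum f k α N = ∫ lam : ℝ, g lam * eulerProd k α N (lam / log N) := by
  have hint : ∀ n : ℕ, Integrable fun lam : ℝ => g lam * omegaTerm α (lam / log N) n := fun n => by
    refine hg.mul_bdd (c := ‖α ^ ArithmeticFunction.cardFactors n / (n : ℂ)‖) ?_
      (.of_forall fun lam => ?_)
    · unfold omegaTerm
      exact (by fun_prop : Continuous _).aestronglyMeasurable
    · rw [omegaTerm, norm_mul, norm_exp_I_mul_mul, one_mul]
  simp_rw [← sum_smoothKFree_omegaTerm hk, mul_sum]
  rw [integral_finsetSum _ fun n _ => hint n, smoothSum]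
  refine sum_congr rfl fun n _ => ?_
  rw [eq_integral_of_isFourierTransform hf hg h, ← integral_mul_const]
  refine integral_congr_ae (.of_forall fun lam => ?_)
  simp only [omegaTerm, ← mul_assoc]
  congr 3
  push_cast
  ring

theorem exists_eulerProd_eq_mul_exp {k : ℕ} {α : ℂ} (hk : 2 ≤ k) (hα : ‖α‖ < 2) :
    ∃ C : ℂ, C ≠ 0 ∧ ∃ K, 0 < K ∧ ∀ᶠ N : ℝ in atTop, ∀ lam : ℝ, ∃ E : ℂ,
      ‖E‖ ≤ K * (1 + |lam|) * (log (log N) / log N) ∧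
        eulerProd k α N (lam / log N) =
          C * (log N : ℂ) ^ α * (dickmanChar α lam * Complex.exp E) := by
  obtain ⟨M, K₁, hK₁, hlinear⟩ := exists_norm_sum_primeWeight_sub_le α
  obtain ⟨S, K₂, hK₂, hlocal⟩ := exists_norm_sum_localLog_primeWeight_sub_le hk hα
  refine ⟨Complex.exp (M + S), Complex.exp_ne_zero _, K₁ + K₂, by positivity, ?_⟩
  filter_upwards [hlinear, eventually_gt_atTop 1,
    (tendsto_log_atTop.comp tendsto_log_atTop).eventually_ge_atTop 1] with N hlinearN hN hloglog lam
  have hlog : 0 < log N := log_pos hN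
  replace hloglog : 1 ≤ log (log N) := hloglog
  refine ⟨_, (norm_add_le_of_le (hlinearN lam) (hlocal N hN lam)).trans ?_, ?_⟩
  · rw [div_eq_mul_one_div (K₂ * _), add_mul K₁, add_mul (K₁ * _)]
    gcongr
  · rw [eulerProd_eq_exp (by omega) hα, dickmanChar_eq_exp,
      Complex.cpow_def_of_ne_zero (by exact_mod_cast hlog.ne'), ← Complex.ofReal_log hlog.le,
      ← Complex.exp_add, ← Complex.exp_add, ← Complex.exp_add, sum_add_distrib]
    ring_nf

theorem exists_norm_eulerProd_div_sub_le {k : ℕ} {α : ℂ} (hk : 2 ≤ k) (hα : ‖α‖ < 2) :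
    ∃ C : ℂ, C ≠ 0 ∧ ∃ K, 0 < K ∧ ∀ᶠ N : ℝ in atTop, ∀ lam : ℝ,
      K * (1 + |lam|) * (log (log N) / log N) ≤ 1 →
        ‖eulerProd k α N (lam / log N) / (C * (log N : ℂ) ^ α) - dickmanChar α lam‖ ≤
          2 * K * (log (log N) / log N) * (1 + |lam|) * ‖dickmanChar α lam‖ := by
  obtain ⟨C, hC, K, hK, heuler⟩ := exists_eulerProd_eq_mul_exp hk hα
  refine ⟨C, hC, K, hK, ?_⟩
  filter_upwards [heuler, eventually_gt_atTop 1] with N hN hN1 lam hsmall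
  obtain ⟨E, hE, heq⟩ := hN lam
  have hlog : (log N : ℂ) ≠ 0 := by exact_mod_cast (log_pos hN1).ne'
  have hD : C * (log N : ℂ) ^ α ≠ 0 := mul_ne_zero hC (by simp [Complex.cpow_eq_zero_iff, hlog])
  calc _ = ‖Complex.exp E - 1‖ * ‖dickmanChar α lam‖ := by
        rw [heq, mul_div_cancel_left₀ _ hD, ← norm_mul]
        ring_nf
    _ ≤ 2 * ‖E‖ * ‖dickmanChar α lam‖ := by
        gcongr
        exact Complex.norm_exp_sub_one_le (hE.trans hsmall)
    _ ≤ 2 * (K * (1 + |lam|) * (log (log N) / log N)) * ‖dickmanChar α lam‖ := by gcongr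
    _ = _ := by ring

theorem exists_norm_smoothSum_div_sub_mainIntegral_le {k : ℕ} {α : ℂ} (hk : 2 ≤ k)
    (hα : ‖α‖ < 2) :
    ∃ C : ℂ, C ≠ 0 ∧ ∃ K, 0 < K ∧ ∀ (η : ℝ) (f g : ℝ → ℂ), 1 < η → Continuous f → MemS η f g →
      ∃ B, 0 < B ∧ ∀ᶠ N : ℝ in atTop, ∀ R, 0 < R →
        K * (1 + R) * (log (log N) / log N) ≤ 1 →
          ‖smoothSum f k α N / (C * (log N : ℂ) ^ α) - mainIntegral α g R‖ ≤
            B * (log (log N) / log N *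
                (∫ lam in {lam : ℝ | |lam| ≤ R}, (1 + |lam|) ^ (-(η + α.re - 1))) +
              log N ^ (‖α‖ - α.re) * R ^ (1 - η)) := by
  obtain ⟨C, hC, K, hK, hcompare⟩ := exists_norm_eulerProd_div_sub_le hk hα
  obtain ⟨K₁, hK₁, heuler⟩ := exists_norm_eulerProd_le hk hα
  refine ⟨C, hC, K, hK, fun η f g hη hf ⟨hft, A, hA, hgA⟩ => ?_⟩
  obtain ⟨B, hB, hgB⟩ := exists_norm_le_one_add_abs_rpow (by linarith) hA hgA
  have hgm := aestronglyMeasurable_of_isFourierTransform hft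
  have hg : Integrable g :=
    ((integrable_one_add_abs_rpow hη).const_mul B).mono' hgm (.of_forall hgB)
  set B₁ := B * exp (4 * ‖α‖) * (2 * K)
  set B₂ := B * (K₁ / ‖C‖) * (2 / (η - 1))
  have hC' : 0 < ‖C‖ := norm_pos_iff.mpr hC
  have hη' : 0 < η - 1 := by linarith
  refine ⟨B₁ + B₂, by positivity, ?_⟩
  filter_upwards [hcompare, eventually_ge_atTop 2,
    (tendsto_log_atTop.comp tendsto_log_atTop).eventually_ge_atTop 0] with N hN hN2 hloglog R hR
    hsmall
  have hlog : 0 < log N := log_pos (by linarith)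
  replace hloglog : 0 ≤ log (log N) := hloglog
  have hQM : ∀ lam, ‖eulerProd k α N (lam / log N) / (C * (log N : ℂ) ^ α)‖ ≤
      K₁ / ‖C‖ * log N ^ (‖α‖ - α.re) := fun lam => by
    rw [norm_div, norm_mul, Complex.norm_cpow_eq_rpow_re_of_pos hlog, rpow_sub hlog,
      div_mul_div_comm]
    gcongr
    exact heuler N hN2 _
  have hbound := norm_integral_mul_sub_mainIntegral_le (α := α) hη (by positivity) hR hgm hgB
    (((continuous_eulerProd k α N).comp (continuous_id.div_const _)).div_const _) hQM
    fun lam hlam => hN lam (hsmall.trans' (by gcongr))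
  simp only [← mul_div_assoc, integral_div] at hbound
  rw [smoothSum_eq_integral (by omega) α hf hg hft]
  set I := ∫ lam in {lam : ℝ | |lam| ≤ R}, (1 + |lam|) ^ (-(η + α.re - 1))
  have hI : 0 ≤ I := integral_nonneg fun lam => by positivity
  calc _ ≤ B₁ * (log (log N) / log N * I) + B₂ * (log N ^ (‖α‖ - α.re) * R ^ (1 - η)) :=
        hbound.trans_eq (by ring)
    _ ≤ (B₁ + B₂) * (log (log N) / log N * I) +
          (B₁ + B₂) * (log N ^ (‖α‖ - α.re) * R ^ (1 - η)) := by
        gcongr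
        · exact le_add_of_nonneg_right (by positivity)
        · exact le_add_of_nonneg_left (by positivity)
    _ = _ := (mul_add _ _ _).symm

/-! ### The error term -/

/-- The `ε_N` of the asymptotic expansion with leading constant `C` and truncation
`R(N) = (log N) ^ (1 - τ)`. -/
noncomputable def errorTerm (f g : ℝ → ℂ) (k : ℕ) (α C : ℂ) (τ N : ℝ) : ℂ :=
  smoothSum f k α N / (C * (log N : ℂ) ^ α) - mainIntegral α g (log N ^ (1 - τ))

/-- The size of the error term in the variable `L = log N`: the first summand comes from the
frequencies `|λ| ≤ L ^ (1 - τ)`, the second one from the tail of the Fourier integral. -/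
noncomputable def errorBound (s e τ L : ℝ) : ℝ :=
  log L / L * (∫ lam in {lam : ℝ | |lam| ≤ L ^ (1 - τ)}, (1 + |lam|) ^ (-s)) + L ^ e

theorem smoothSum_eq_mul_mainIntegral_add_errorTerm (f g : ℝ → ℂ) (k : ℕ) (α : ℂ) {C : ℂ}
    (hC : C ≠ 0) (τ : ℝ) {N : ℝ} (hN : 1 < N) :
    smoothSum f k α N =
      C * (log N : ℂ) ^ α * (mainIntegral α g (log N ^ (1 - τ)) + errorTerm f g k α C τ N) := by
  have hlog : (log N : ℂ) ≠ 0 := by exact_mod_cast (log_pos hN).ne'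
  have hD : C * (log N : ℂ) ^ α ≠ 0 := mul_ne_zero hC (by simp [Complex.cpow_eq_zero_iff, hlog])
  rw [errorTerm, add_sub_cancel, mul_div_cancel₀ _ hD]

theorem tendsto_one_add_rpow_mul_log_div {τ : ℝ} (hτ : 0 < τ) :
    Tendsto (fun L => (1 + L ^ (1 - τ)) * (log L / L)) atTop (nhds 0) := by
  have hlim := (isLittleO_log_id_atTop.tendsto_div_nhds_zero).add
    (isLittleO_log_rpow_atTop hτ).tendsto_div_nhds_zero
  rw [add_zero] at hlim
  refine hlim.congr' ?_
  filter_upwards [eventually_gt_atTop 0] with L hL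
  rw [rpow_sub hL, rpow_one, id_eq]
  field_simp

theorem exists_isBigO_errorTerm {k : ℕ} {α : ℂ} (hk : 2 ≤ k) (hα : ‖α‖ < 2) :
    ∃ C : ℂ, C ≠ 0 ∧ ∀ (η τ : ℝ) (f g : ℝ → ℂ), 1 < η → 0 < τ → Continuous f → MemS η f g →
      errorTerm f g k α C τ =O[atTop] fun N => errorBound (η + α.re - 1)
        (‖α‖ - α.re + (1 - τ) * (1 - η)) τ (log N) := by
  obtain ⟨C, hC, K, -, hmain⟩ := exists_norm_smoothSum_div_sub_mainIntegral_le hk hα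
  refine ⟨C, hC, fun η τ f g hη hτ hf hS => ?_⟩
  obtain ⟨B, hB, hbound⟩ := hmain η f g hη hf hS
  have hlim := ((tendsto_one_add_rpow_mul_log_div hτ).const_mul K).comp tendsto_log_atTop
  rw [mul_zero] at hlim
  refine .of_bound B ?_
  filter_upwards [hbound, hlim.eventually_le_const one_pos,
    tendsto_log_atTop.eventually_gt_atTop 0] with N hN hsmall hlog
  rw [Function.comp_apply, ← mul_assoc] at hsmall
  rw [errorTerm, errorBound, rpow_add hlog, rpow_mul hlog.le]
  exact (hN _ (by positivity) hsmall).trans (by gcongr; exact le_abs_self _)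

theorem setIntegral_one_add_abs_rpow_le {s q R : ℝ} (hR : 1 ≤ R) (hq : 0 ≤ q) (hs : 1 < s + q) :
    ∫ lam in {lam : ℝ | |lam| ≤ R}, (1 + |lam|) ^ (-s) ≤
      2 ^ q * (∫ lam : ℝ, (1 + |lam|) ^ (-(s + q))) * R ^ q := by
  have hint := integrable_one_add_abs_rpow hs
  have hpow : (1 + R) ^ q ≤ 2 ^ q * R ^ q := by
    rw [← mul_rpow zero_le_two (by linarith)]
    gcongr
    linarith
  have hmono : ∀ lam, |lam| ≤ R → (1 + |lam|) ^ (-s) ≤ (1 + R) ^ q * (1 + |lam|) ^ (-(s + q)) :=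
    fun lam hlam => by
      rw [show -s = q + -(s + q) by ring, rpow_add (by positivity)]
      gcongr
  have hnonneg : 0 ≤ ∫ lam : ℝ, (1 + |lam|) ^ (-(s + q)) :=
    integral_nonneg fun lam => by positivity
  calc _ ≤ ∫ lam in {lam : ℝ | |lam| ≤ R}, (1 + R) ^ q * (1 + |lam|) ^ (-(s + q)) :=
        setIntegral_mono_on (integrableOn_abs_le_of_continuous (continuous_one_add_abs_rpow _) R)
          (hint.const_mul _).integrableOn (measurableSet_abs_le R) hmono
    _ ≤ (1 + R) ^ q * ∫ lam : ℝ, (1 + |lam|) ^ (-(s + q)) := by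
        rw [integral_const_mul]
        gcongr
        exacts [.of_forall fun lam => by positivity, Measure.restrict_le_self]
    _ ≤ 2 ^ q * R ^ q * ∫ lam : ℝ, (1 + |lam|) ^ (-(s + q)) := by gcongr
    _ = _ := by ring

theorem isBigO_setIntegral_one_add_abs_rpow {s q τ : ℝ} (hτ : τ ≤ 1) (hq : 0 ≤ q)
    (hs : 1 < s + q) :
    (fun L : ℝ => ∫ lam in {lam : ℝ | |lam| ≤ L ^ (1 - τ)}, (1 + |lam|) ^ (-s)) =O[atTop]
      fun L => L ^ ((1 - τ) * q) := by
  refine .of_bound (2 ^ q * ∫ lam : ℝ, (1 + |lam|) ^ (-(s + q))) ?_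
  filter_upwards [eventually_ge_atTop 1] with L hL
  have hL0 : 0 ≤ L := by linarith
  rw [norm_of_nonneg (integral_nonneg fun lam => by positivity), norm_of_nonneg (by positivity),
    rpow_mul hL0]
  exact setIntegral_one_add_abs_rpow_le (one_le_rpow hL (by linarith)) hq hs

theorem isBigO_rpow_log_div {e : ℝ} (he : e ≤ -1) :
    (fun L : ℝ => L ^ e) =O[atTop] fun L => log L / L := by
  refine .of_bound 1 ?_
  filter_upwards [eventually_ge_atTop 1, tendsto_log_atTop.eventually_ge_atTop 1] with L hL hlog
  have hL0 : 0 < L := by linarith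
  rw [one_mul, norm_of_nonneg (by positivity), norm_of_nonneg (by positivity), ← one_mul (L ^ e),
    div_eq_mul_inv, ← rpow_neg_one]
  gcongr

theorem isBigO_errorBound_log_div {s e τ : ℝ} (hτ : τ ≤ 1) (hs : 1 < s) (he : e ≤ -1) :
    errorBound s e τ =O[atTop] fun L => log L / L := by
  have hint := isBigO_setIntegral_one_add_abs_rpow hτ le_rfl (hs.trans_eq (add_zero s).symm)
  simp only [mul_zero, rpow_zero] at hint
  have hnear := (isBigO_refl (fun L => log L / L) atTop).mul hint
  simp only [mul_one] at hnear
  exact hnear.add (isBigO_rpow_log_div he)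

theorem isBigO_errorBound_rpow {s e τ : ℝ} (hτ : τ < 1) (he : 0 < e + 1)
    (hs : (1 - τ) * (1 - s) < e + 1) : errorBound s e τ =O[atTop] fun L => L ^ e := by
  have hτ' : 0 < 1 - τ := by linarith
  obtain ⟨q, hq, hqe⟩ : ∃ q, max 0 (1 - s) < q ∧ q < (e + 1) / (1 - τ) :=
    exists_between (max_lt (div_pos he hτ') ((lt_div_iff₀' hτ').mpr hs))
  rw [max_lt_iff] at hq
  rw [lt_div_iff₀' hτ'] at hqe
  have hint := isBigO_setIntegral_one_add_abs_rpow hτ.le hq.1.le (by linarith [hq.2] : 1 < s + q)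
  have hlog := (isLittleO_log_rpow_atTop (by linarith : 0 < e + 1 - (1 - τ) * q)).isBigO
  have hnear := (hlog.mul (isBigO_refl (fun L : ℝ => L⁻¹) atTop)).mul hint
  simp only [← div_eq_mul_inv] at hnear
  refine .add (hnear.congr' .rfl ?_) (isBigO_refl _ _)
  filter_upwards [eventually_gt_atTop 0] with L hL
  rw [← rpow_sub_one hL.ne', ← rpow_add hL]
  ring_nf

end SmoothSums

theorem corollary2 (k : ℕ) (hk : 2 ≤ k) (α : ℂ) (hα0 : α ≠ 0) (hα : ‖α‖ < 2) :
    ∃ C : ℂ, C ≠ 0 ∧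
      ∀ (η : ℝ) (f fhat : ℝ → ℂ) (τ : ℝ),
        ‖α‖ - α.re + 1 < η →
        Continuous f →
        (∃ M : ℝ, ∀ x : ℝ, ‖f x‖ ≤ M) →
        SmoothSums.MemS η f fhat →
        ∃ ε : ℝ → ℂ,
          (∀ N : ℝ, 2 ≤ N →
            SmoothSums.smoothSum f k α N =
              C * (Real.log N : ℂ) ^ α *
                (SmoothSums.mainIntegral α fhat (Real.log N ^ (1 - τ)) + ε N)) ∧
          (0 < τ → τ ≤ (η - (‖α‖ - α.re + 2)) / (η - 1) →
            ε =O[Filter.atTop] fun N : ℝ => Real.log (Real.log N) / Real.log N) ∧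
          (max 0 ((η - (‖α‖ - α.re + 2)) / (η - 1)) < τ →
            τ < (η - (‖α‖ - α.re + 1)) / (η - 1) →
            ε =O[Filter.atTop] fun N : ℝ =>
              Real.log N ^ (-η * (1 - τ) - τ + (‖α‖ - α.re + 1))) := by
  obtain ⟨C, hC, herror⟩ := SmoothSums.exists_isBigO_errorTerm hk hα
  refine ⟨C, hC, fun η f fhat τ hη hf _ hS => ⟨SmoothSums.errorTerm f fhat k α C τ,
    fun N hN => SmoothSums.smoothSum_eq_mul_mainIntegral_add_errorTerm f fhat k α hC τ
      (by linarith), fun hτ hτ' => ?_, fun hτ hτ' => ?_⟩⟩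
  all_goals
    have hre : α.re ≤ ‖α‖ := Complex.re_le_norm α
    have hη1 : 0 < η - 1 := by linarith
  · have hτ1 : τ ≤ 1 := hτ'.trans ((div_le_one hη1).mpr (by linarith))
    have hτη : τ * (η - 1) ≤ η - (‖α‖ - α.re + 2) := (le_div_iff₀ hη1).mp hτ'
    have hs : 1 < η + α.re - 1 := by linarith [mul_pos hτ hη1, norm_nonneg α]
    exact (herror η τ f fhat (by linarith) hτ hf hS).trans
      ((SmoothSums.isBigO_errorBound_log_div hτ1 hs (by linarith)).comp_tendsto
        Real.tendsto_log_atTop)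
  · obtain ⟨hτ0, hτη⟩ := max_lt_iff.mp hτ
    rw [div_lt_iff₀ hη1] at hτη
    have hτ1 : τ < 1 := hτ'.trans_le ((div_le_one hη1).mpr (by linarith))
    have hτα : τ * (α.re - 1) < ‖α‖ := by nlinarith [norm_nonneg α]
    rw [show -η * (1 - τ) - τ + (‖α‖ - α.re + 1) = ‖α‖ - α.re + (1 - τ) * (1 - η) by ring]
    exact (herror η τ f fhat (by linarith) hτ0 hf hS).trans
      ((SmoothSums.isBigO_errorBound_rpow hτ1 (by linarith) (by linarith)).comp_tendsto
        Real.tendsto_log_atTop)
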